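/- Let $f:\mathbb R^n\to\mathbb R$ be convex and differentiable with $\|\nabla f(u)-\nabla f(v)\|\le L\|u-v\|$ for all $u,v$ ($L>0$). Let $m\ge 2$, $d\ge 1$, $\beta\in(0,1)$, $c\in(0,\tfrac12)$, $M_1,M_2>0$, $x_0\in\mathbb R^n$, let $H_0\in\mathbb R^{m\times m}$ be symmetric with $M_1I\preceq H_0\preceq M_2I$, and let $P_{\rm init}\in\mathbb R^{n\times m}$ have columns that are each of norm $1$ or zero. Let $Q_0,Q_1,\dots\in\mathbb R^{n\times d}$ be independent random matrices with independent $N(0,1)$ entries. For a matrix $A$ and $\varepsilon>0$ let $\nabla_{A,\varepsilon}f(x)$ be the vector with entries $\big(f(x+\varepsilon Ae_i)-f(x-\varepsilon Ae_i)\big)/(2\varepsilon)$. The finite-difference subspace quasi-Newton method with precisions $\varepsilon_k>0$ performs, for $k=0,1,\dots$: (1) $P_k$ is obtained from $P_{k-1}$ ($P_{-1}:=P_{\rm init}$) by deleting the first two columns and appending $x_k/\|x_k\|$ and $w_k/\|w_k\|$, where $w_k=Q_k\nabla_{Q_k,\varepsilon_k}f(x_k)$ (a zero vector is left as $0$); (2)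 $d_k=-H_k\nabla_{P_k,\varepsilon_k}f(x_k)$; (3) $\alpha_k$ is the first of $1,\beta,\beta^2,\dots$ with $f(x_k+\alpha_kP_kd_k)\le f(x_k)+c\,\alpha_k\nabla_{P_k,\varepsilon_k}f(x_k)^\top d_k$, and $\alpha_k=0$ if there is none; (4) $x_{k+1}=x_k+\alpha_kP_kd_k$; (5) with $s=\alpha_kd_k$ and $y=\nabla_{P_k,\varepsilon_k}f(x_{k+1})-\nabla_{P_k,\varepsilon_k}f(x_k)$ let $\tilde H_{k+1}=\big(I-\tfrac{sy^\top}{s^\top y}\big)H_k\big(I-\tfrac{ys^\top}{s^\top y}\big)+\tfrac{ss^\top}{s^\top y}$ ($\tilde H_{k+1}=H_k$ if $s^\top y=0$), and obtain $H_{k+1}$ from $\tilde H_{k+1}$ by replacing its eigenvalues below $M_1$ by $M_1$ and those above $M_2$ by $M_2$. Let $f^*=\inf f$, let $\Omega$ be the set of minimizers of $f$, and suppose that $R_0=\sup_{x:\,f(x)\le f(x_0)}\inf_{x^*\in\Omega}\|x-x^*\|$ is finite (in particular $\Omega\ne\emptyset$). Let $\mathcal C_0,\mathcal C>0$ be constants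 such that, for an $n\times d$ matrix $Q$ with independent $N(0,1)$ entries, $(1-\epsilon)\|x\|^2\le\|Q^\top x/\sqrt d\|^2\le(1+\epsilon)\|x\|^2$ holds with probability at least $1-2e^{-\mathcal C_0\epsilon^2d}$ for all $\epsilon\in(0,1)$ and $x\in\mathbb R^n$, and $\tfrac1d\|QQ^\top\|_{\rm op}\le\mathcal C\tfrac nd$ holds with probability at least $1-2e^{-d}$; absolute constants that do this for all $1\le d\le n$ exist. Put $$p(\epsilon)=1-\big(2e^{-\mathcal C_0\epsilon^2d}+2e^{-d}\big),\qquad \bar\alpha=\min\Big(1,\frac{2\beta(1-2c)}{mM_2L}\Big),\qquad K=\max\Big(\frac{4\sqrt d\,\mathcal Cn}{1-\epsilon},\ \frac{6\,\mathcal Cnm^2}{d}\Big(\frac{M_2}{M_1c}+1\Big)\Big)L .$$ If $\varepsilon_k=\varepsilon>0$ for all $k$, then for every $\epsilon\in(0,1)$ with $p(\epsilon)\ge0$ and every $k\ge0$, $$\mathbb E[f(x_k)-f^*]\le\frac{L\,\mathcal C^2n^2R_0^2}{2\,\mathcal C^2n^2+L\,c\,M_1\,p(\epsilon)(1-\epsilon)^2d^2k\bar\alpha}+2R_0K\varepsilon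 .$$ If instead the precisions $\varepsilon_k>0$ satisfy $\varepsilon_k=O(1/k)$, then $\mathbb E[f(x_k)-f^*]=O(1/k)$. -/

import Mathlib

open MeasureTheory ProbabilityTheory Filter Asymptotics
open scoped ENNReal Matrix

noncomputable section

namespace SubspaceQN

/-- Euclidean space `ℝⁿ`. -/
abbrev E (n : ℕ) : Type := EuclideanSpace ℝ (Fin n)

/-! ### Gaussian matrices and the constants of their tail bounds -/

/-- Law of an `n × d` random matrix with independent standard normal entries. -/
def gaussianMatrix (n d : ℕ) : Measure (Fin n → Fin d → ℝ) :=
  Measure.pi fun _ => Measure.pi fun _ => gaussianReal 0 1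

/-- `C₀` is a constant for which, for every `δ ∈ (0,1)` and `x`, the inequalities
`(1-δ)‖x‖² ≤ ‖Qᵀx/√d‖² ≤ (1+δ)‖x‖²` hold with probability at least `1 - 2exp(-C₀δ²d)`. -/
def IsVectorNormConst (n d : ℕ) (C₀ : ℝ) : Prop :=
  0 < C₀ ∧ ∀ δ : ℝ, 0 < δ → δ < 1 → ∀ x : E n,
    1 - 2 * Real.exp (-C₀ * δ ^ 2 * d) ≤
      (gaussianMatrix n d).real {Q |
        (1 - δ) * ‖x‖ ^ 2 ≤ ‖(1 / √(d : ℝ)) • (Matrix.of Q)ᵀ.toEuclideanLin x‖ ^ 2 ∧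
        ‖(1 / √(d : ℝ)) • (Matrix.of Q)ᵀ.toEuclideanLin x‖ ^ 2 ≤ (1 + δ) * ‖x‖ ^ 2}

/-- `C` is a constant for which `‖QQᵀ‖_op / d ≤ C n / d` holds with probability at least
`1 - 2exp(-d)`. -/
def IsOpNormConst (n d : ℕ) (C : ℝ) : Prop :=
  0 < C ∧ 1 - 2 * Real.exp (-(d : ℝ)) ≤
    (gaussianMatrix n d).real {Q |
      1 / (d : ℝ) * ‖Matrix.toEuclideanCLM (𝕜 := ℝ) (Matrix.of Q * (Matrix.of Q)ᵀ)‖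
        ≤ C * (n / d)}

/-- The probability bound `p(δ) = 1 - (2exp(-C₀δ²d) + 2exp(-d))`. -/
def probBound (C₀ δ : ℝ) (d : ℕ) : ℝ :=
  1 - (2 * Real.exp (-C₀ * δ ^ 2 * d) + 2 * Real.exp (-(d : ℝ)))

/-! ### One iteration of the finite-difference subspace quasi-Newton method -/

/-- Central finite differences of `f` at `x` along the columns of `A`, with precision `ε`. -/
def fdGrad {n r : ℕ} (f : E n → ℝ) (A : Matrix (Fin n) (Fin r) ℝ) (ε : ℝ) (x : E n) : E r :=
  WithLp.toLp 2 fun i =>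
    (f (x + ε • WithLp.toLp 2 (A.col i)) - f (x - ε • WithLp.toLp 2 (A.col i))) / (2 * ε)

/-- `v / ‖v‖`, and `0` for `v = 0`. -/
def unitVec {n : ℕ} (v : E n) : E n := ‖v‖⁻¹ • v

/-- Delete the first two columns of `P` and append the columns `x/‖x‖` and `w/‖w‖`. -/
def updateP {n m : ℕ} (P : Matrix (Fin n) (Fin m) ℝ) (x w : E n) : Matrix (Fin n) (Fin m) ℝ :=
  Matrix.of fun i j =>
    if h : (j : ℕ) + 2 < m then P i ⟨j + 2, h⟩
    else if (j : ℕ) + 2 = m then unitVec x i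
    else unitVec w i

/-- The BFGS update of an inverse Hessian approximation. By the convention `0⁻¹ = 0` the matrix
`H` is left unchanged when `sᵀy = 0`, where the formula has no meaning. -/
def bfgs {m : ℕ} (H : Matrix (Fin m) (Fin m) ℝ) (s y : Fin m → ℝ) : Matrix (Fin m) (Fin m) ℝ :=
  (1 - (s ⬝ᵥ y)⁻¹ • Matrix.vecMulVec s y) * H * (1 - (s ⬝ᵥ y)⁻¹ • Matrix.vecMulVec y s)
    + (s ⬝ᵥ y)⁻¹ • Matrix.vecMulVec s s

/-- Replace the eigenvalues below `M₁` by `M₁` and those above `M₂` by `M₂`, keeping the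
eigenvectors. It is only ever applied to symmetric matrices. -/
def modifyEig {m : ℕ} (M₁ M₂ : ℝ) (A : Matrix (Fin m) (Fin m) ℝ) : Matrix (Fin m) (Fin m) ℝ :=
  cfc (fun t : ℝ => max M₁ (min t M₂)) A

open Classical in
/-- Backtracking: the first `βⁱ`, `i = 0, 1, …`, for which `accept (βⁱ)` holds. If no `βⁱ` is
accepted, the step is `0 = lim βⁱ`, i.e. the iterate stays where it is. -/
def backtrack (β : ℝ) (accept : ℝ → Prop) : ℝ :=
  if h : ∃ i : ℕ, accept (β ^ i) then β ^ Nat.find h else 0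

/-- The current iterate `x = x_k`, the subspace matrix `P = P_{k-1}` of the previous iteration and
the inverse Hessian approximation `H = H_k`. -/
structure State (n m : ℕ) where
  x : E n
  P : Matrix (Fin n) (Fin m) ℝ
  H : Matrix (Fin m) (Fin m) ℝ

/-- One iteration, with finite-difference precision `ε` and sampled matrix `Q`. -/
def step {n m d : ℕ} (f : E n → ℝ) (β c M₁ M₂ ε : ℝ) (Q : Matrix (Fin n) (Fin d) ℝ)
    (S : State n m) : State n m :=
  let P := updateP S.P S.x (Q.toEuclideanLin (fdGrad f Q ε S.x))
  let h := fdGrad f P ε S.x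
  let dir := -(S.H.toEuclideanLin h)
  let α := backtrack β fun a =>
    f (S.x + a • P.toEuclideanLin dir) ≤ f S.x + c * a * (h.ofLp ⬝ᵥ dir.ofLp)
  let x' := S.x + α • P.toEuclideanLin dir
  { x := x'
    P := P
    H := modifyEig M₁ M₂ (bfgs S.H (α • dir).ofLp (fdGrad f P ε x' - h).ofLp) }

/-- The state before iteration `k`, started at `S₀`, when iteration `k` uses the precision `ε k`
and the sampled matrix `Q k`. -/
def run {n m d : ℕ} (f : E n → ℝ) (β c M₁ M₂ : ℝ) (ε : ℕ → ℝ)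
    (Q : ℕ → Matrix (Fin n) (Fin d) ℝ) (S₀ : State n m) : ℕ → State n m
  | 0 => S₀
  | k + 1 => step f β c M₁ M₂ (ε k) (Q k) (run f β c M₁ M₂ ε Q S₀ k)

/-! ### Quantities in the bound -/

/-- The set of optimal solutions. -/
def solutions {n : ℕ} (f : E n → ℝ) : Set (E n) := {x | ∀ y, f x ≤ f y}

/-- `R₀ = sup {dist(x, Ω) : f x ≤ f x₀}` with `Ω` the set of optimal solutions, as an extended
real; it is `⊤` when `Ω` is empty. -/
def levelRadius {n : ℕ} (f : E n → ℝ) (x₀ : E n) : ℝ≥0∞ :=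
  ⨆ x ∈ {x : E n | f x ≤ f x₀}, Metric.infEDist x (solutions f)

/-- The optimal value `f*`. -/
def optVal {n : ℕ} (f : E n → ℝ) : ℝ := ⨅ x, f x

/-- The lower bound `ᾱ = min(1, 2β(1-2c)/(m M₂ L))` of the step sizes. -/
def alphaBar (β c M₂ L : ℝ) (m : ℕ) : ℝ := min 1 (2 * β * (1 - 2 * c) / (m * M₂ * L))

/-- `K = max(4√d C n/(1-δ), (6 C n m²/d)(M₂/(M₁c) + 1)) L`. -/
def constK (C δ c M₁ M₂ L : ℝ) (n m d : ℕ) : ℝ :=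
  max (4 * √(d : ℝ) * C * n / (1 - δ)) (6 * C * n * m ^ 2 / d * (M₂ / (M₁ * c) + 1)) * L

end SubspaceQN

end

/-! Only the newest column of `P_k` has to make progress. Write g = ∇f(x_k). That column is the
direction of w ≈ QQᵀg, and if ‖Q‖² ≤ N and ‖Qᵀg‖² ≥ s²N‖g‖², then ⟨g, w/‖w‖⟩ ≥ ‖Qᵀg‖/√N ≥ s‖g‖ up to
finite-difference errors (`div_sqrt_le_abs_inner_unitVec`). Hence the vector h of finite differences
along `P_k` has norm at least s‖g‖ minus a multiple of the precision. Of the other columns and of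
the quasi-Newton matrix only ‖column‖ ≤ 1 and M₁I ≼ H ≼ M₂I matter. Once h dominates its own error,
every step size up to 2(1-2c)/(mM₂L) passes the Armijo test, so for ‖g‖ ≥ 2Kε a good Q decreases f
by at least cᾱM₁s²(‖g‖-2Kε)² (`step_decrease`). A bad Q does no harm, because f never increases
(`step_le`).

Convexity gives f - f* ≤ R₀‖g‖. Since x_k is independent of Q_k, the good event has probability at
least p whatever x_k is, and Jensen's inequality yields D_{k+1} ≤ D_k - b(D_k - τ_k)₊² for D_k =
E[f(x_k)-f*] and τ_k = 2R₀Kε_k (`integral_gap_succ_le`). With D_0 ≤ LR₀²/2 this solves to the bound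
for fixed precision, and for τ_k = O(1/k) to O(1/k).

The delicate point is that the given K must dominate all errors. With s² = (1-δ)d/(Cn) the estimates
need d ≤ 15138(1-δ)Cn. When this fails, 1-δ is so small that the factor (1-δ)² in the claimed rate
leaves room to replace 1-δ by 1/50, whose probability is estimated directly (`exists_good_level`).

The constants exist by Chernoff bounds for ‖Qᵀx‖² and, for the operator norm, by integrating
exp(‖Qw‖²/16) over a ball of vectors w, which replaces a covering argument. -/

noncomputable section

namespace SubspaceQN

/-! ### Smooth convex functions: finite differences, and the gap bounded by the gradient. -/

section Smooth

variable {n : ℕ} {f : E n → ℝ} {L : ℝ}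

lemma hasDerivAt_line (hf : Differentiable ℝ f) (x v : E n) (t : ℝ) :
    HasDerivAt (fun s : ℝ => f (x + s • v)) (inner ℝ (gradient f (x + t • v)) v) t := by
  have h1 : HasFDerivAt f (InnerProductSpace.toDual ℝ _ (gradient f (x + t • v))) (x + t • v) :=
    (hf (x + t • v)).hasGradientAt.hasFDerivAt
  have h2 : HasDerivAt (fun s : ℝ => x + s • v) v t := by
    simpa using ((hasDerivAt_id t).smul_const v).const_add x
  exact h1.comp_hasDerivAt t h2

lemma descent_le (hf : Differentiable ℝ f)
    (hLip : ∀ u v, ‖gradient f u - gradient f v‖ ≤ L * ‖u - v‖) (x v : E n) :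
    f (x + v) ≤ f x + inner ℝ (gradient f x) v + L / 2 * ‖v‖ ^ 2 := by
  let φ : ℝ → ℝ := fun t => f (x + t • v) - t * inner ℝ (gradient f x) v - L / 2 * ‖v‖ ^ 2 * t ^ 2
  have hφ : ∀ t, HasDerivAt φ (inner ℝ (gradient f (x + t • v)) v - inner ℝ (gradient f x) v
      - L * ‖v‖ ^ 2 * t) t := by
    intro t
    have h := ((hasDerivAt_line hf x v t).sub
      ((hasDerivAt_id t).mul_const (inner ℝ (gradient f x) v))).sub
      (((hasDerivAt_pow 2 t)).const_mul (L / 2 * ‖v‖ ^ 2))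
    refine h.congr_deriv ?_
    simp; ring
  have hanti : AntitoneOn φ (Set.Icc 0 1) := by
    apply antitoneOn_of_deriv_nonpos (convex_Icc 0 1)
    · exact fun t _ => (hφ t).continuousAt.continuousWithinAt
    · exact fun t _ => (hφ t).differentiableAt.differentiableWithinAt
    · intro t ht
      rw [interior_Icc] at ht
      rw [(hφ t).deriv, ← inner_sub_left]
      have h1 := real_inner_le_norm (gradient f (x + t • v) - gradient f x) v
      have h2 := hLip (x + t • v) x
      rw [add_sub_cancel_left, norm_smul, Real.norm_of_nonneg ht.1.le] at h2
      nlinarith [mul_le_mul_of_nonneg_right h2 (norm_nonneg v)]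
  have := hanti (by simp : (0 : ℝ) ∈ Set.Icc (0 : ℝ) 1) (by simp : (1 : ℝ) ∈ Set.Icc (0 : ℝ) 1)
    zero_le_one
  simp only [φ, one_smul, zero_smul, add_zero] at this
  linarith

lemma gradient_le (hf : Differentiable ℝ f) (hconv : ConvexOn ℝ Set.univ f) (x v : E n) :
    f x + inner ℝ (gradient f x) v ≤ f (x + v) := by
  have hc : ConvexOn ℝ Set.univ (fun s : ℝ => f (x + s • v)) := by
    have := hconv.comp_affineMap (AffineMap.lineMap x (x + v) : ℝ →ᵃ[ℝ] E n)
    simpa [Function.comp_def, AffineMap.lineMap_apply, add_comm] using this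
  have h := hasDerivAt_line hf x v 0
  have := hc.le_slope_of_hasDerivAt (Set.mem_univ 0) (Set.mem_univ 1) zero_lt_one h
  simp only [slope_def_field, one_smul, zero_smul, add_zero, sub_zero, div_one] at this
  linarith

/-- Both f(x+εp) and f(x-εp) exceed their linearisations by an amount in [0, Lε²‖p‖²/2]: below by
convexity, above by smoothness. The difference of the two remainders then stays within Lε²‖p‖²/2,
which is half of what smoothness alone would give. -/
lemma abs_central_diff_sub_le (hf : Differentiable ℝ f) (hconv : ConvexOn ℝ Set.univ f)
    (hLip : ∀ u v, ‖gradient f u - gradient f v‖ ≤ L * ‖u - v‖) {ε : ℝ} (hε : 0 < ε) (x p : E n) :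
    |(f (x + ε • p) - f (x - ε • p)) / (2 * ε) - inner ℝ (gradient f x) p|
      ≤ L * ε / 4 * ‖p‖ ^ 2 := by
  have a1 := gradient_le hf hconv x (ε • p)
  have a2 := gradient_le hf hconv x ((-ε) • p)
  have b1 := descent_le hf hLip x (ε • p)
  have b2 := descent_le hf hLip x ((-ε) • p)
  rw [neg_smul, ← sub_eq_add_neg, ← neg_smul] at a2 b2
  simp only [inner_smul_right, norm_smul, norm_neg, Real.norm_of_nonneg hε.le, mul_pow] at a1 a2 b1 b2
  rw [div_sub' (by positivity), abs_div, abs_of_pos (by positivity : 0 < 2 * ε),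
    div_le_iff₀ (by positivity), abs_le]
  constructor <;> nlinarith

/-! ### Distance to the solution set -/

lemma solutions_nonempty {x₀ : E n} (hR : levelRadius f x₀ ≠ ⊤) : (solutions f).Nonempty := by
  by_contra h
  rw [Set.not_nonempty_iff_eq_empty] at h
  apply hR
  rw [levelRadius, h, eq_top_iff]
  exact le_iSup₂_of_le x₀ (le_refl (f x₀)) (by simp)

/-- The solution set is closed and the space is proper, so the distance is attained. -/
lemma exists_solution_dist_le (hf : Differentiable ℝ f) {x₀ : E n} (hR : levelRadius f x₀ ≠ ⊤)
    {x : E n} (hx : f x ≤ f x₀) :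
    ∃ z ∈ solutions f, ‖x - z‖ ≤ (levelRadius f x₀).toReal := by
  have hcl : IsClosed (solutions f) := by
    have : solutions f = ⋂ y, {x | f x ≤ f y} := by ext; simp [solutions]
    rw [this]
    exact isClosed_iInter fun y => isClosed_le hf.continuous continuous_const
  obtain ⟨z, hz, hd⟩ := hcl.exists_infDist_eq_dist (solutions_nonempty hR) x
  refine ⟨z, hz, ?_⟩
  rw [← dist_eq_norm, ← hd, Metric.infDist]
  refine ENNReal.toReal_mono hR ?_
  exact le_iSup₂_of_le (f := fun x (_ : x ∈ {x : E n | f x ≤ f x₀}) =>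
    Metric.infEDist x (solutions f)) x hx le_rfl

lemma optVal_eq {z : E n} (hz : z ∈ solutions f) : optVal f = f z :=
  le_antisymm (ciInf_le ⟨f z, by rintro _ ⟨y, rfl⟩; exact hz y⟩ z) (le_ciInf hz)

lemma optVal_le {x₀ : E n} (hR : levelRadius f x₀ ≠ ⊤) (x : E n) : optVal f ≤ f x := by
  obtain ⟨z, hz⟩ := solutions_nonempty hR
  rw [optVal_eq hz]; exact hz x

lemma sub_optVal_le_gradient (hf : Differentiable ℝ f) (hconv : ConvexOn ℝ Set.univ f)
    {x₀ : E n} (hR : levelRadius f x₀ ≠ ⊤) {x : E n} (hx : f x ≤ f x₀) :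
    f x - optVal f ≤ (levelRadius f x₀).toReal * ‖gradient f x‖ := by
  obtain ⟨z, hz, hd⟩ := exists_solution_dist_le hf hR hx
  rw [optVal_eq hz]
  have h := gradient_le hf hconv x (z - x)
  rw [add_sub_cancel] at h
  have h2 := abs_real_inner_le_norm (gradient f x) (z - x)
  rw [norm_sub_rev] at h2
  nlinarith [neg_abs_le (inner ℝ (gradient f x) (z - x)),
    mul_le_mul_of_nonneg_left hd (norm_nonneg (gradient f x))]

lemma gradient_eq_zero_of_mem_solutions {z : E n} (hz : z ∈ solutions f) : gradient f z = 0 := by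
  have : IsLocalMin f z := Filter.Eventually.of_forall hz
  rw [gradient, this.fderiv_eq_zero, map_zero]

/-- The gradient vanishes at a nearest minimizer, so the descent inequality from there has no linear
term. This provides the initial value of the recursion. -/
lemma sub_optVal_le_sq (hf : Differentiable ℝ f) (hL : 0 < L)
    (hLip : ∀ u v, ‖gradient f u - gradient f v‖ ≤ L * ‖u - v‖)
    {x₀ : E n} (hR : levelRadius f x₀ ≠ ⊤) :
    f x₀ - optVal f ≤ L / 2 * (levelRadius f x₀).toReal ^ 2 := by
  obtain ⟨z, hz, hd⟩ := exists_solution_dist_le hf hR (le_refl (f x₀))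
  rw [optVal_eq hz]
  have h := descent_le hf hLip z (x₀ - z)
  rw [add_sub_cancel, gradient_eq_zero_of_mem_solutions hz, inner_zero_left] at h
  have : ‖x₀ - z‖ ^ 2 ≤ (levelRadius f x₀).toReal ^ 2 := by gcongr
  nlinarith

end Smooth

/-! ### Norm bounds for matrices, the subspace update, and spectral bounds. -/

section Matrices

variable {n m r : ℕ}

lemma inner_toEuclideanLin_transpose (A : Matrix (Fin n) (Fin r) ℝ) (x : E n) (v : E r) :
    inner ℝ (Aᵀ.toEuclideanLin x) v = inner ℝ x (A.toEuclideanLin v) := by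
  rw [← Matrix.conjTranspose_eq_transpose_of_trivial, Matrix.toEuclideanLin_conjTranspose_eq_adjoint,
    LinearMap.adjoint_inner_left]

lemma toEuclideanLin_transpose_apply (A : Matrix (Fin n) (Fin r) ℝ) (x : E n) (i : Fin r) :
    Aᵀ.toEuclideanLin x i = inner ℝ x (WithLp.toLp 2 (A.col i) : E n) := by
  simp [Matrix.toLpLin_apply, Matrix.mulVec, dotProduct, PiLp.inner_apply, Matrix.col]

lemma toEuclideanLin_single (A : Matrix (Fin n) (Fin r) ℝ) (i : Fin r) :
    A.toEuclideanLin (EuclideanSpace.single i 1) = WithLp.toLp 2 (A.col i) := by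
  ext j; simp [Matrix.toLpLin_apply]

lemma norm_toEuclideanLin_sq_le (A : Matrix (Fin n) (Fin r) ℝ)
    (hA : ∀ j, ‖(WithLp.toLp 2 (A.col j) : E n)‖ ≤ 1) (v : E r) :
    ‖A.toEuclideanLin v‖ ^ 2 ≤ r * ‖v‖ ^ 2 := by
  have h1 : A.toEuclideanLin v = ∑ i, v i • (WithLp.toLp 2 (A.col i) : E n) := by
    ext j
    simp [Matrix.toLpLin_apply, Matrix.mulVec, dotProduct, mul_comm]
  have h2 : ‖A.toEuclideanLin v‖ ≤ ∑ i, |v i| := by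
    rw [h1]
    refine (norm_sum_le _ _).trans (Finset.sum_le_sum fun i _ => ?_)
    rw [norm_smul, Real.norm_eq_abs]
    exact mul_le_of_le_one_right (abs_nonneg _) (hA i)
  calc ‖A.toEuclideanLin v‖ ^ 2 ≤ (∑ i, |v i|) ^ 2 := by gcongr
    _ ≤ (Finset.univ : Finset (Fin r)).card * ∑ i, |v i| ^ 2 := sq_sum_le_card_mul_sum_sq
    _ = r * ‖v‖ ^ 2 := by simp [EuclideanSpace.norm_sq_eq]

/-- From ‖Av‖² = ⟨Aᵀ(Av), v⟩ ≤ ‖Aᵀ(Av)‖‖v‖, square, apply the bound for Aᵀ at Av, and cancel ‖Av‖².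
-/
lemma norm_transpose_toEuclideanLin_sq_le (A : Matrix (Fin n) (Fin r) ℝ) {N : ℝ} (hN : 0 ≤ N)
    (hA : ∀ x, ‖Aᵀ.toEuclideanLin x‖ ^ 2 ≤ N * ‖x‖ ^ 2) (v : E r) :
    ‖A.toEuclideanLin v‖ ^ 2 ≤ N * ‖v‖ ^ 2 := by
  rcases eq_or_ne (A.toEuclideanLin v) 0 with h0 | h0
  · rw [h0]; simp; positivity
  have hpos : 0 < ‖A.toEuclideanLin v‖ := norm_pos_iff.2 h0
  have h1 : ‖A.toEuclideanLin v‖ ^ 2 ≤ ‖Aᵀ.toEuclideanLin (A.toEuclideanLin v)‖ * ‖v‖ := by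
    rw [← real_inner_self_eq_norm_sq, ← inner_toEuclideanLin_transpose]
    exact real_inner_le_norm _ _
  have h2 := hA (A.toEuclideanLin v)
  have h3 : (‖A.toEuclideanLin v‖ ^ 2) ^ 2 ≤ ‖A.toEuclideanLin v‖ ^ 2 * (N * ‖v‖ ^ 2) :=
    calc (‖A.toEuclideanLin v‖ ^ 2) ^ 2
        ≤ (‖Aᵀ.toEuclideanLin (A.toEuclideanLin v)‖ * ‖v‖) ^ 2 := by gcongr
      _ = ‖Aᵀ.toEuclideanLin (A.toEuclideanLin v)‖ ^ 2 * ‖v‖ ^ 2 := by ring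
      _ ≤ N * ‖A.toEuclideanLin v‖ ^ 2 * ‖v‖ ^ 2 := by gcongr
      _ = _ := by ring
  rw [sq (‖A.toEuclideanLin v‖ ^ 2)] at h3
  exact le_of_mul_le_mul_left h3 (by positivity)

lemma norm_toEuclideanLin_sq_le_opNorm (A : Matrix (Fin n) (Fin r) ℝ) {N : ℝ} (hN : 0 ≤ N)
    (hA : ‖Matrix.toEuclideanCLM (𝕜 := ℝ) (A * Aᵀ)‖ ≤ N) (v : E r) :
    ‖A.toEuclideanLin v‖ ^ 2 ≤ N * ‖v‖ ^ 2 := by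
  refine norm_transpose_toEuclideanLin_sq_le A hN (fun x => ?_) v
  rw [← real_inner_self_eq_norm_sq, inner_toEuclideanLin_transpose]
  have h1 : A.toEuclideanLin (Aᵀ.toEuclideanLin x)
      = Matrix.toEuclideanCLM (𝕜 := ℝ) (A * Aᵀ) x := by
    ext i
    simp [Matrix.toLpLin_apply, ← Matrix.mulVec_mulVec]
  rw [h1]
  have h2 := real_inner_le_norm x (Matrix.toEuclideanCLM (𝕜 := ℝ) (A * Aᵀ) x)
  have h3 := (Matrix.toEuclideanCLM (𝕜 := ℝ) (A * Aᵀ)).le_of_opNorm_le hA x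
  nlinarith [mul_le_mul_of_nonneg_left h3 (norm_nonneg x)]

lemma opNorm_mul_transpose_le (A : Matrix (Fin n) (Fin r) ℝ) {N : ℝ} (hN : 0 ≤ N)
    (hA : ∀ v, ‖A.toEuclideanLin v‖ ^ 2 ≤ N * ‖v‖ ^ 2) :
    ‖Matrix.toEuclideanCLM (𝕜 := ℝ) (A * Aᵀ)‖ ≤ N := by
  refine ContinuousLinearMap.opNorm_le_bound _ hN fun x => ?_
  have h1 : Matrix.toEuclideanCLM (𝕜 := ℝ) (A * Aᵀ) x
      = A.toEuclideanLin (Aᵀ.toEuclideanLin x) := by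
    ext i
    simp [Matrix.toLpLin_apply, ← Matrix.mulVec_mulVec]
  rw [h1]
  have h2 := norm_transpose_toEuclideanLin_sq_le Aᵀ hN (by simpa using hA) x
  have h3 := hA (Aᵀ.toEuclideanLin x)
  refine abs_le_of_sq_le_sq' ?_ (by positivity) |>.2
  calc _ ≤ _ := h3
    _ ≤ N * (N * ‖x‖ ^ 2) := by gcongr
    _ = _ := by ring

lemma norm_unitVec_le {n : ℕ} (v : E n) : ‖unitVec v‖ ≤ 1 := by
  rw [unitVec, norm_smul, norm_inv, norm_norm]
  exact inv_mul_le_one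

lemma updateP_col_norm_le (P : Matrix (Fin n) (Fin m) ℝ)
    (hP : ∀ j, ‖(WithLp.toLp 2 (P.col j) : E n)‖ ≤ 1) (x w : E n) (j : Fin m) :
    ‖(WithLp.toLp 2 ((updateP P x w).col j) : E n)‖ ≤ 1 := by
  by_cases h : (j : ℕ) + 2 < m
  · convert hP ⟨j + 2, h⟩ using 2
    ext i; simp [updateP, h]
  · by_cases h' : (j : ℕ) + 2 = m
    · convert norm_unitVec_le x using 2
      ext i; simp [updateP, h']
    · convert norm_unitVec_le w using 2
      ext i; simp [updateP, h, h']

lemma updateP_col_last (P : Matrix (Fin n) (Fin m) ℝ) (x w : E n) (hm : 2 ≤ m) :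
    (WithLp.toLp 2 ((updateP P x w).col ⟨m - 1, by omega⟩) : E n) = unitVec w := by
  ext i
  have h1 : ¬ (m - 1 + 2 < m) := by omega
  have h2 : ¬ (m - 1 + 2 = m) := by omega
  simp [updateP, h1, h2]

/-! ### Matrices between two multiples of the identity -/

/-- `M₁ I ≼ H ≼ M₂ I`. -/
def Bounded (M₁ M₂ : ℝ) (H : Matrix (Fin m) (Fin m) ℝ) : Prop :=
  (H - M₁ • (1 : Matrix (Fin m) (Fin m) ℝ)).PosSemidef ∧
    (M₂ • (1 : Matrix (Fin m) (Fin m) ℝ) - H).PosSemidef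

variable {M₁ M₂ : ℝ} {H : Matrix (Fin m) (Fin m) ℝ}

lemma Bounded.isHermitian (hH : Bounded M₁ M₂ H) : H.IsHermitian := by
  have := hH.1.isHermitian.add
    ((Matrix.isHermitian_one (n := Fin m) (α := ℝ)).smul (k := M₁) (by simp [IsSelfAdjoint]))
  simpa using this

lemma inner_nonneg_of_posSemidef {A : Matrix (Fin m) (Fin m) ℝ} (hA : A.PosSemidef) (v : E m) :
    0 ≤ inner ℝ v (A.toEuclideanLin v) := by
  have := (Matrix.isPositive_toEuclideanLin_iff.2 hA).2 v
  rw [real_inner_comm]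
  simpa using this

lemma Bounded.le_inner (hH : Bounded M₁ M₂ H) (v : E m) :
    M₁ * ‖v‖ ^ 2 ≤ inner ℝ v (H.toEuclideanLin v) := by
  have := inner_nonneg_of_posSemidef hH.1 v
  simp only [map_sub, map_smul, LinearMap.sub_apply, LinearMap.smul_apply, inner_sub_right,
    inner_smul_right, Matrix.toLpLin_one, LinearMap.id_apply, real_inner_self_eq_norm_sq] at this
  linarith

lemma Bounded.inner_le (hH : Bounded M₁ M₂ H) (v : E m) :
    inner ℝ v (H.toEuclideanLin v) ≤ M₂ * ‖v‖ ^ 2 := by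
  have := inner_nonneg_of_posSemidef hH.2 v
  simp only [map_sub, map_smul, LinearMap.sub_apply, LinearMap.smul_apply, inner_sub_right,
    inner_smul_right, Matrix.toLpLin_one, LinearMap.id_apply, real_inner_self_eq_norm_sq] at this
  linarith

/-- This is H² ≼ M₂H without a square root of H: expand 0 ≤ ⟨v - u/M₂, H(v - u/M₂)⟩ for u = Hv and
use ⟨u, Hu⟩ ≤ M₂‖u‖². Bounding ‖Hv‖² by the quadratic form, not by ‖v‖², is what puts M₂, and not
M₂²/M₁, into the admissible step size. -/
lemma Bounded.norm_sq_le (hM₁ : 0 < M₁) (hM₂ : 0 < M₂) (hH : Bounded M₁ M₂ H) (v : E m) :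
    ‖H.toEuclideanLin v‖ ^ 2 ≤ M₂ * inner ℝ v (H.toEuclideanLin v) := by
  set u := H.toEuclideanLin v with hu
  have hsym : inner ℝ v (H.toEuclideanLin u) = ‖u‖ ^ 2 := by
    rw [← inner_toEuclideanLin_transpose, ← Matrix.conjTranspose_eq_transpose_of_trivial,
      hH.isHermitian.eq, ← hu, real_inner_self_eq_norm_sq]
  have h1 : 0 ≤ inner ℝ (v - M₂⁻¹ • u) (H.toEuclideanLin (v - M₂⁻¹ • u)) :=
    (by positivity : 0 ≤ M₁ * ‖v - M₂⁻¹ • u‖ ^ 2).trans (hH.le_inner _)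
  have h2 := hH.inner_le u
  simp only [map_sub, map_smul, inner_sub_left, inner_sub_right, inner_smul_left, inner_smul_right,
    ← hu, hsym, real_inner_self_eq_norm_sq, conj_trivial] at h1
  have h3 : M₂⁻¹ * (M₂⁻¹ * inner ℝ u (H.toEuclideanLin u)) ≤ M₂⁻¹ * (M₂⁻¹ * (M₂ * ‖u‖ ^ 2)) := by
    gcongr
  rw [inv_mul_cancel_left₀ hM₂.ne'] at h3
  have h4 : M₂⁻¹ * ‖u‖ ^ 2 ≤ inner ℝ v u := by linarith
  rw [inv_mul_le_iff₀ hM₂] at h4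
  exact h4

lemma Bounded.le [NeZero m] (hH : Bounded M₁ M₂ H) : M₁ ≤ M₂ := by
  have h1 := hH.le_inner (EuclideanSpace.single 0 1)
  have h2 := hH.inner_le (EuclideanSpace.single 0 1)
  simp only [PiLp.norm_single, norm_one, one_pow, mul_one] at h1 h2
  linarith

open scoped MatrixOrder in
lemma bounded_modifyEig (h : M₁ ≤ M₂) (hH : H.IsHermitian) : Bounded M₁ M₂ (modifyEig M₁ M₂ H) := by
  have hsa : IsSelfAdjoint H := hH
  constructor
  · rw [← Matrix.le_iff, ← Algebra.algebraMap_eq_smul_one, modifyEig]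
    exact algebraMap_le_cfc _ _ _ (fun x _ => le_max_left _ _) (by fun_prop) hsa
  · rw [← Matrix.le_iff, ← Algebra.algebraMap_eq_smul_one, modifyEig]
    exact cfc_le_algebraMap _ _ _ (fun x _ => max_le h (min_le_right _ _)) (by fun_prop) hsa

lemma isHermitian_bfgs (hH : H.IsHermitian) (s y : Fin m → ℝ) : (bfgs H s y).IsHermitian := by
  have hH' : Hᵀ = H := by rw [← Matrix.conjTranspose_eq_transpose_of_trivial, hH.eq]
  rw [Matrix.IsHermitian, Matrix.conjTranspose_eq_transpose_of_trivial, bfgs]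
  simp [Matrix.transpose_mul, hH', Matrix.mul_assoc, Matrix.transpose_vecMulVec]

end Matrices

/-! ### One iteration: line search and decrease of the objective. -/

section Step

variable {n m d : ℕ} {f : E n → ℝ} {L : ℝ}

lemma norm_fdGrad_sub_sq_le {r : ℕ} (hf : Differentiable ℝ f) (hconv : ConvexOn ℝ Set.univ f)
    (hL : 0 < L) (hLip : ∀ u v, ‖gradient f u - gradient f v‖ ≤ L * ‖u - v‖)
    (A : Matrix (Fin n) (Fin r) ℝ) {ε B : ℝ} (hε : 0 < ε)
    (hA : ∀ j, ‖(WithLp.toLp 2 (A.col j) : E n)‖ ^ 2 ≤ B) (x : E n) :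
    ‖fdGrad f A ε x - Aᵀ.toEuclideanLin (gradient f x)‖ ^ 2 ≤ r * (L * ε / 4 * B) ^ 2 := by
  rw [EuclideanSpace.norm_sq_eq]
  calc _ ≤ ∑ _i : Fin r, (L * ε / 4 * B) ^ 2 := by
        refine Finset.sum_le_sum fun i _ => ?_
        rw [PiLp.sub_apply, toEuclideanLin_transpose_apply, Real.norm_eq_abs]
        refine pow_le_pow_left₀ (abs_nonneg _) ?_ 2
        refine (abs_central_diff_sub_le hf hconv hLip hε x _).trans ?_
        have := hA i
        gcongr
    _ = _ := by simp

lemma abs_fdGrad_apply_sub_le {r : ℕ} (hf : Differentiable ℝ f) (hconv : ConvexOn ℝ Set.univ f)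
    (hL : 0 < L) (hLip : ∀ u v, ‖gradient f u - gradient f v‖ ≤ L * ‖u - v‖)
    (A : Matrix (Fin n) (Fin r) ℝ) {ε : ℝ} (hε : 0 < ε) (j : Fin r)
    (hA : ‖(WithLp.toLp 2 (A.col j) : E n)‖ ≤ 1) (x : E n) :
    |fdGrad f A ε x j - inner ℝ (gradient f x) (WithLp.toLp 2 (A.col j) : E n)| ≤ L * ε / 4 := by
  refine (abs_central_diff_sub_le hf hconv hLip hε x _).trans ?_
  exact mul_le_of_le_one_right (by positivity) (pow_le_one₀ (norm_nonneg _) hA)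

/-! ### Backtracking -/

lemma backtrack_accept_or {β : ℝ} {p : ℝ → Prop} : p (backtrack β p) ∨ backtrack β p = 0 := by
  classical
  unfold backtrack
  split_ifs with h
  · exact Or.inl (by classical exact Nat.find_spec h)
  · exact Or.inr rfl

lemma backtrack_nonneg {β : ℝ} (hβ : 0 < β) {p : ℝ → Prop} : 0 ≤ backtrack β p := by
  unfold backtrack
  split_ifs with h
  · positivity
  · exact le_rfl

/-- If the first power β⁰ is not chosen, the power preceding the chosen one was rejected, hence
exceeds a₀; one more factor β gives the lower bound. -/
lemma backtrack_spec {β a₀ : ℝ} (hβ : 0 < β) (hβ1 : β < 1) (ha₀ : 0 < a₀) {p : ℝ → Prop}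
    (hp : ∀ a, 0 < a → a ≤ a₀ → p a) :
    p (backtrack β p) ∧ min 1 (β * a₀) ≤ backtrack β p := by
  classical
  have h : ∃ i : ℕ, p (β ^ i) := by
    obtain ⟨i, hi⟩ := exists_pow_lt_of_lt_one ha₀ hβ1
    exact ⟨i, hp _ (by positivity) hi.le⟩
  have hb : backtrack β p = β ^ Nat.find h := by rw [backtrack, dif_pos h]
  rw [hb]
  refine ⟨Nat.find_spec h, ?_⟩
  rcases hk : Nat.find h with _ | k
  · simp
  · have h1 : ¬ p (β ^ k) := Nat.find_min h (by omega)
    have h2 : a₀ < β ^ k := by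
      by_contra hcon
      exact h1 (hp _ (by positivity) (not_lt.1 hcon))
    rw [pow_succ']
    exact (min_le_right _ _).trans (by gcongr)

/-! ### The line search -/

lemma dotProduct_neg_toEuclideanLin (H : Matrix (Fin m) (Fin m) ℝ) (h : E m) :
    h.ofLp ⬝ᵥ (-(H.toEuclideanLin h)).ofLp = -inner ℝ h (H.toEuclideanLin h) := by
  simp [PiLp.inner_apply, dotProduct, mul_comm]

/-- `αP d` decreases `f` sufficiently when `α ≤ 2(1-2c)/(m M₂ L)` and the finite differences `h`
dominate their error. -/
lemma sufficient_decrease (hf : Differentiable ℝ f)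
    (hL : 0 < L) (hLip : ∀ u v, ‖gradient f u - gradient f v‖ ≤ L * ‖u - v‖)
    {c M₁ M₂ : ℝ} (hc : 0 < c) (hM₁ : 0 < M₁) (hM₂ : 0 < M₂) (hm : 0 < m)
    {P : Matrix (Fin n) (Fin m) ℝ} (hP : ∀ j, ‖(WithLp.toLp 2 (P.col j) : E n)‖ ≤ 1)
    {H : Matrix (Fin m) (Fin m) ℝ} (hH : Bounded M₁ M₂ H) (x : E n) (h : E m) {η : ℝ}
    (he : ‖h - Pᵀ.toEuclideanLin (gradient f x)‖ ^ 2 ≤ η)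
    (hη : η * M₂ ≤ c ^ 2 * (M₁ * ‖h‖ ^ 2)) {a : ℝ} (ha : 0 < a)
    (ha' : a ≤ 2 * (1 - 2 * c) / (m * M₂ * L)) :
    f (x + a • P.toEuclideanLin (-(H.toEuclideanLin h)))
      ≤ f x + c * a * (h.ofLp ⬝ᵥ (-(H.toEuclideanLin h)).ofLp) := by
  rw [dotProduct_neg_toEuclideanLin]
  set g := gradient f x
  set u := H.toEuclideanLin h with hu
  set q := inner ℝ h u with hq
  have hq0 : M₁ * ‖h‖ ^ 2 ≤ q := hH.le_inner h
  have hqn : 0 ≤ q := (by positivity : 0 ≤ M₁ * ‖h‖ ^ 2).trans hq0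
  have hu2 : ‖u‖ ^ 2 ≤ M₂ * q := hH.norm_sq_le hM₁ hM₂ h
  have h1 := descent_le hf hLip x (a • P.toEuclideanLin (-u))
  -- The error of h costs a share c of q and the Armijo test claims another, so 1-2c is left for the
  -- quadratic term.
  have h2 : inner ℝ g (P.toEuclideanLin (-u)) ≤ -q + c * q := by
    rw [← inner_toEuclideanLin_transpose]
    have e1 : inner ℝ (Pᵀ.toEuclideanLin g) (-u)
        = -q + inner ℝ (h - Pᵀ.toEuclideanLin g) u := by
      rw [inner_sub_left, inner_neg_right]; ring
    rw [e1]
    have e2 := real_inner_le_norm (h - Pᵀ.toEuclideanLin g) u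
    have e3 : ‖h - Pᵀ.toEuclideanLin g‖ * ‖u‖ ≤ c * q := by
      refine abs_le_of_sq_le_sq' ?_ (by positivity) |>.2
      calc (‖h - Pᵀ.toEuclideanLin g‖ * ‖u‖) ^ 2
          = ‖h - Pᵀ.toEuclideanLin g‖ ^ 2 * ‖u‖ ^ 2 := by ring
        _ ≤ η * (M₂ * q) := by gcongr; exact (sq_nonneg _).trans he
        _ = η * M₂ * q := by ring
        _ ≤ c ^ 2 * (M₁ * ‖h‖ ^ 2) * q := by gcongr
        _ ≤ c ^ 2 * q * q := by gcongr
        _ = (c * q) ^ 2 := by ring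
    linarith
  have h3 : ‖P.toEuclideanLin (-u)‖ ^ 2 ≤ m * (M₂ * q) := by
    refine (norm_toEuclideanLin_sq_le P hP _).trans ?_
    rw [norm_neg]; gcongr
  rw [inner_smul_right, norm_smul, mul_pow, Real.norm_of_nonneg ha.le] at h1
  have hm' : (0 : ℝ) < m := by exact_mod_cast hm
  rw [le_div_iff₀ (by positivity)] at ha'
  have h4 : L / 2 * (a ^ 2 * ‖P.toEuclideanLin (-u)‖ ^ 2) ≤ a * ((1 - 2 * c) * q) := by
    calc _ ≤ L / 2 * (a ^ 2 * (m * (M₂ * q))) := by gcongr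
      _ = a * ((a * (m * M₂ * L)) / 2 * q) := by ring
      _ ≤ a * ((2 * (1 - 2 * c)) / 2 * q) := by gcongr
      _ = _ := by ring
  have h5 : a * inner ℝ g (P.toEuclideanLin (-u)) ≤ a * (-q + c * q) := by gcongr
  linarith

/-- With z = Aᵀg and w = Ab one has ⟨g, w⟩ = ⟨z, b⟩ ≥ ‖b‖(‖b‖-e) and ‖w‖ ≤ √N‖b‖. The factor ‖b‖
cancels after normalising, and ‖b‖ ≥ ‖z‖-e. If the left side is not positive there is nothing to
prove, which also covers w = 0. -/
lemma div_sqrt_le_abs_inner_unitVec (A : Matrix (Fin n) (Fin d) ℝ) {N e : ℝ} (hN : 0 < N)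
    (hA : ∀ v, ‖A.toEuclideanLin v‖ ^ 2 ≤ N * ‖v‖ ^ 2) (g : E n) (b : E d)
    (hb : ‖b - Aᵀ.toEuclideanLin g‖ ≤ e) :
    (‖Aᵀ.toEuclideanLin g‖ - 2 * e) / √N ≤ |inner ℝ g (unitVec (A.toEuclideanLin b))| := by
  set z := Aᵀ.toEuclideanLin g with hz
  set w := A.toEuclideanLin b with hw
  have hsN : 0 < √N := Real.sqrt_pos.2 hN
  have hin : inner ℝ g w = inner ℝ z b := (inner_toEuclideanLin_transpose A g b).symm
  have hzb : ‖b‖ * (‖b‖ - e) ≤ inner ℝ g w := by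
    have e1 : inner ℝ z b = ‖b‖ ^ 2 - inner ℝ (b - z) b := by
      rw [inner_sub_left, real_inner_self_eq_norm_sq]; ring
    have e2 := real_inner_le_norm (b - z) b
    have e3 := mul_le_mul_of_nonneg_right hb (norm_nonneg b)
    rw [hin, e1]; nlinarith
  have htri : ‖z‖ - e ≤ ‖b‖ := by
    have := norm_sub_norm_le z (z - b)
    rw [sub_sub_cancel, norm_sub_rev] at this
    linarith
  have he : 0 ≤ e := (norm_nonneg _).trans hb
  have hww : ‖w‖ ≤ √N * ‖b‖ := by
    refine abs_le_of_sq_le_sq' ?_ (by positivity) |>.2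
    rw [mul_pow, Real.sq_sqrt hN.le]; exact hA b
  rcases le_or_gt (‖z‖ - 2 * e) 0 with hneg | hpos
  · exact (div_nonpos_of_nonpos_of_nonneg hneg hsN.le).trans (abs_nonneg _)
  refine le_trans ?_ (le_abs_self _)
  have hbe : ‖z‖ - 2 * e ≤ ‖b‖ - e := by linarith
  have hbpos : 0 < ‖b‖ := by linarith
  have hwpos : 0 < ‖w‖ := by
    refine norm_pos_iff.2 fun h0 => ?_
    rw [h0, inner_zero_right] at hzb
    nlinarith
  rw [unitVec, inner_smul_right, inv_mul_eq_div, div_le_div_iff₀ hsN hwpos]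
  calc (‖z‖ - 2 * e) * ‖w‖ ≤ (‖z‖ - 2 * e) * (√N * ‖b‖) := by gcongr
    _ = ‖b‖ * (‖z‖ - 2 * e) * √N := by ring
    _ ≤ ‖b‖ * (‖b‖ - e) * √N := by
        exact mul_le_mul_of_nonneg_right (mul_le_mul_of_nonneg_left hbe hbpos.le) hsN.le
    _ ≤ _ := by gcongr

/-! ### One iteration -/

/-- The columns of `P` have norm at most one and `M₁ I ≼ H ≼ M₂ I`. -/
def Admissible (M₁ M₂ : ℝ) (S : State n m) : Prop :=
  (∀ j, ‖(WithLp.toLp 2 (S.P.col j) : E n)‖ ≤ 1) ∧ Bounded M₁ M₂ S.H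

variable {β c M₁ M₂ ε : ℝ} {S : State n m} {Q : Matrix (Fin n) (Fin d) ℝ}

lemma Admissible.step (hm : 2 ≤ m) (hS : Admissible M₁ M₂ S) :
    Admissible M₁ M₂ (step f β c M₁ M₂ ε Q S) := by
  have : NeZero m := ⟨by omega⟩
  exact ⟨updateP_col_norm_le _ hS.1 _ _,
    bounded_modifyEig hS.2.le (isHermitian_bfgs hS.2.isHermitian _ _)⟩

lemma Admissible.run (hm : 2 ≤ m) (hS : Admissible M₁ M₂ S) (ε : ℕ → ℝ)
    (Q : ℕ → Matrix (Fin n) (Fin d) ℝ) (k : ℕ) :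
    Admissible M₁ M₂ (run f β c M₁ M₂ ε Q S k) := by
  induction k with
  | zero => exact hS
  | succ k ih => exact ih.step hm

/-- An accepted step has hᵀd = -hᵀHh ≤ 0, and a failed search leaves x in place. No assumption on Q
or on the precision enters. -/
lemma step_le (hβ : 0 < β) (hc : 0 < c) (hM₁ : 0 < M₁) (hS : Admissible M₁ M₂ S) :
    f (step f β c M₁ M₂ ε Q S).x ≤ f S.x := by
  simp only [step]
  generalize fdGrad f (updateP S.P S.x (Q.toEuclideanLin (fdGrad f Q ε S.x))) ε S.x = h
  generalize updateP S.P S.x (Q.toEuclideanLin (fdGrad f Q ε S.x)) = P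
  set p : ℝ → Prop := fun a =>
    f (S.x + a • P.toEuclideanLin (-(S.H.toEuclideanLin h)))
      ≤ f S.x + c * a * (h.ofLp ⬝ᵥ (-(S.H.toEuclideanLin h)).ofLp)
  rcases backtrack_accept_or (β := β) (p := p) with hacc | h0
  · refine hacc.trans ?_
    rw [dotProduct_neg_toEuclideanLin]
    have h1 := (by positivity : 0 ≤ M₁ * ‖h‖ ^ 2).trans (hS.2.le_inner h)
    have h2 := backtrack_nonneg hβ (p := p)
    have : 0 ≤ c * backtrack β p * inner ℝ h (S.H.toEuclideanLin h) := by positivity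
    linarith
  · rw [h0]; simp

/-- The decrease in one iteration, when `Q` does not distort the gradient too much and the gradient
is large compared with the precision. -/
lemma step_decrease (hf : Differentiable ℝ f) (hconv : ConvexOn ℝ Set.univ f) (hL : 0 < L)
    (hLip : ∀ u v, ‖gradient f u - gradient f v‖ ≤ L * ‖u - v‖) (hβ : 0 < β) (hβ1 : β < 1)
    (hc : 0 < c) (hc1 : c < 1 / 2) (hM₁ : 0 < M₁) (hM₂ : 0 < M₂) (hm : 2 ≤ m)
    (hS : Admissible M₁ M₂ S) (hε : 0 < ε) {N s K : ℝ} (hN : 0 < N) (hs : 0 < s)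
    (hQN : ∀ v, ‖Q.toEuclideanLin v‖ ^ 2 ≤ N * ‖v‖ ^ 2)
    (hQs : s ^ 2 * N * ‖gradient f S.x‖ ^ 2 ≤ ‖Qᵀ.toEuclideanLin (gradient f S.x)‖ ^ 2)
    (hK₁ : 4 * L * √(d * N) ≤ s * K) (hK₂ : 4 * L ≤ s * K)
    (hK₃ : m * (L / 4) ^ 2 * M₂ ≤ c ^ 2 * (M₁ * (29 / 16 * (s * K)) ^ 2))
    (hg : 2 * K * ε ≤ ‖gradient f S.x‖) :
    f (step f β c M₁ M₂ ε Q S).x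
      ≤ f S.x - c * alphaBar β c M₂ L m * M₁ * s ^ 2 * (‖gradient f S.x‖ - 2 * K * ε) ^ 2 := by
  have hm0 : (0 : ℝ) < m := by exact_mod_cast (by omega : 0 < m)
  simp only [step]
  set g := gradient f S.x with hgdef
  set b := fdGrad f Q ε S.x with hbdef
  set P := updateP S.P S.x (Q.toEuclideanLin b) with hPdef
  have hP : ∀ j, ‖(WithLp.toLp 2 (P.col j) : E n)‖ ≤ 1 := updateP_col_norm_le _ hS.1 _ _
  set h := fdGrad f P ε S.x with hhdef
  set p : ℝ → Prop := fun a =>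
    f (S.x + a • P.toEuclideanLin (-(S.H.toEuclideanLin h)))
      ≤ f S.x + c * a * (h.ofLp ⬝ᵥ (-(S.H.toEuclideanLin h)).ofLp) with hpdef
  -- lower bound for the finite differences along the last column
  have hb : ‖b - Qᵀ.toEuclideanLin g‖ ≤ √d * (L * ε / 4 * N) := by
    refine abs_le_of_sq_le_sq' ?_ (by positivity) |>.2
    rw [mul_pow, Real.sq_sqrt (by positivity)]
    refine norm_fdGrad_sub_sq_le hf hconv hL hLip Q hε (fun j => ?_) _
    -- A column of Q is Q applied to a unit vector, so its squared norm is at most N.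
    rw [← toEuclideanLin_single]
    simpa using hQN (EuclideanSpace.single j 1)
  have hlast := div_sqrt_le_abs_inner_unitVec Q hN hQN g b hb
  have hsN : 0 < √N := Real.sqrt_pos.2 hN
  have hz : s * √N * ‖g‖ ≤ ‖Qᵀ.toEuclideanLin g‖ := by
    refine abs_le_of_sq_le_sq' ?_ (by positivity) |>.2
    rw [mul_pow, mul_pow, Real.sq_sqrt hN.le]; exact hQs
  have hlast' : s * ‖g‖ - L * ε / 2 * √(d * N) ≤ |inner ℝ g (unitVec (Q.toEuclideanLin b))| := by
    refine le_trans ?_ hlast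
    rw [le_div_iff₀ hsN]
    have : (s * ‖g‖ - L * ε / 2 * √(d * N)) * √N
        = s * √N * ‖g‖ - 2 * (√d * (L * ε / 4 * N)) := by
      rw [Real.sqrt_mul (by positivity)]
      nth_rewrite 4 [← Real.mul_self_sqrt hN.le]
      ring
    rw [this]; linarith
  have hcoord : |inner ℝ g (unitVec (Q.toEuclideanLin b))| - L * ε / 4 ≤ ‖h‖ := by
    have e1 := abs_fdGrad_apply_sub_le hf hconv hL hLip P hε ⟨m - 1, by omega⟩ (hP _) S.x
    rw [updateP_col_last _ _ _ hm] at e1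
    have e2 := PiLp.norm_apply_le h ⟨m - 1, by omega⟩
    rw [Real.norm_eq_abs] at e2
    have e3 := abs_sub_abs_le_abs_sub (inner ℝ g (unitVec (Q.toEuclideanLin b)))
      (h ⟨m - 1, by omega⟩)
    rw [abs_sub_comm] at e3
    linarith
  -- The share 3/16 is 1/8 from the error in w plus 1/16 from the difference along the last column.
  have hh : s * ‖g‖ - 3 / 16 * (s * K) * ε ≤ ‖h‖ := by
    have e1 : L * ε / 2 * √(d * N) ≤ 1 / 8 * (s * K) * ε := by
      nlinarith [mul_le_mul_of_nonneg_right hK₁ hε.le]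
    have e2 : L * ε / 4 ≤ 1 / 16 * (s * K) * ε := by
      nlinarith [mul_le_mul_of_nonneg_right hK₂ hε.le]
    linarith
  have hsK : 0 < s * K := by linarith
  -- 29/16 = 2 - 3/16, by ‖g‖ ≥ 2Kε.
  have hh1 : 29 / 16 * (s * K) * ε ≤ ‖h‖ := by
    nlinarith [mul_le_mul_of_nonneg_left hg hs.le]
  have hh2 : s * (‖g‖ - 2 * K * ε) ≤ ‖h‖ := by nlinarith
  -- the line search
  have hη : (m * (L * ε / 4 * 1) ^ 2) * M₂ ≤ c ^ 2 * (M₁ * ‖h‖ ^ 2) := by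
    calc (m * (L * ε / 4 * 1) ^ 2) * M₂ = (m * (L / 4) ^ 2 * M₂) * ε ^ 2 := by ring
      _ ≤ (c ^ 2 * (M₁ * (29 / 16 * (s * K)) ^ 2)) * ε ^ 2 := by gcongr
      _ = c ^ 2 * (M₁ * (29 / 16 * (s * K) * ε) ^ 2) := by ring
      _ ≤ _ := by gcongr
  have he := norm_fdGrad_sub_sq_le hf hconv hL hLip P hε (B := 1)
    (fun j => pow_le_one₀ (norm_nonneg _) (hP j)) S.x
  have ha₀ : 0 < 2 * (1 - 2 * c) / (m * M₂ * L) := by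
    have : 0 < 1 - 2 * c := by linarith
    positivity
  obtain ⟨hacc, hα⟩ := backtrack_spec hβ hβ1 ha₀ (p := p) fun a ha ha' =>
    sufficient_decrease hf hL hLip hc hM₁ hM₂ (by omega) hP hS.2 S.x h he hη ha ha'
  refine hacc.trans ?_
  have hα' : alphaBar β c M₂ L m ≤ backtrack β p := by
    refine le_trans (le_of_eq ?_) hα
    rw [alphaBar]; congr 1; ring
  rw [dotProduct_neg_toEuclideanLin]
  have hq := hS.2.le_inner h
  have hα0 : 0 ≤ alphaBar β c M₂ L m := by
    have : 0 < 1 - 2 * c := by linarith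
    rw [alphaBar]; positivity
  have hfin : c * alphaBar β c M₂ L m * M₁ * s ^ 2 * (‖g‖ - 2 * K * ε) ^ 2
      ≤ c * backtrack β p * inner ℝ h (S.H.toEuclideanLin h) := by
    have hg' : 0 ≤ s * (‖g‖ - 2 * K * ε) := mul_nonneg hs.le (by linarith)
    have hcb : 0 ≤ c * backtrack β p := mul_nonneg hc.le (hα0.trans hα')
    calc _ = c * alphaBar β c M₂ L m * (M₁ * (s * (‖g‖ - 2 * K * ε)) ^ 2) := by ring
      _ ≤ c * backtrack β p * (M₁ * ‖h‖ ^ 2) := by gcongr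
      _ ≤ _ := by gcongr
  linarith

end Step

/-! ### Gaussian matrices: tail bounds and existence of the constants. -/

section Gaussian

instance (n d : ℕ) : IsProbabilityMeasure (gaussianMatrix n d) := by
  unfold gaussianMatrix; infer_instance

/-- The two laws agree on boxes, that is, on products over all entries. Because the product measure
is nested, boxes are used as a generating π-system for each row. -/
lemma gaussianMatrix_map_swap (n d : ℕ) :
    (gaussianMatrix n d).map (fun Q j i => Q i j) = gaussianMatrix d n := by
  have hT : Measurable (fun (Q : Fin n → Fin d → ℝ) (j : Fin d) (i : Fin n) => Q i j) := by fun_prop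
  symm
  refine Measure.pi_eq_generateFrom (C := fun _ => Set.univ.pi '' Set.univ.pi fun _ =>
    {s : Set ℝ | MeasurableSet s}) (fun _ => generateFrom_pi) (fun _ => isPiSystem_pi)
    (fun _ => ⟨fun _ => Set.univ, fun _ => ⟨fun _ => Set.univ, by simp, by simp⟩, by simp,
      Set.iUnion_const _⟩) fun s hs => ?_
  choose t ht hts using hs
  have hmt : ∀ j i, MeasurableSet (t j i) := fun j i => ht j i (Set.mem_univ i)
  rw [Measure.map_apply hT (MeasurableSet.univ_pi fun j => by
    rw [← hts]; exact MeasurableSet.univ_pi (hmt j))]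
  have hpre : (fun (Q : Fin n → Fin d → ℝ) (j : Fin d) (i : Fin n) => Q i j) ⁻¹' Set.univ.pi s
      = Set.univ.pi fun i => Set.univ.pi fun j => t j i := by
    ext Q
    simp only [← hts, Set.mem_preimage, Set.mem_univ_pi]
    exact forall_comm
  rw [hpre, gaussianMatrix, Measure.pi_pi]
  simp_rw [← hts, Measure.pi_pi]
  exact Finset.prod_comm

lemma map_dotProduct_pi_gaussianReal {n : ℕ} (a : E n) :
    (Measure.pi fun _ : Fin n => gaussianReal 0 1).map (fun q => inner ℝ a (WithLp.toLp 2 q))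
      = (gaussianReal 0 1).map (fun x => ‖a‖ * x) := by
  have h1 : (Measure.pi fun _ : Fin n => gaussianReal 0 1).map
      (fun q => inner ℝ a (WithLp.toLp 2 q))
      = (stdGaussian (E n)).map (innerSL ℝ a) := by
    rw [← map_pi_eq_stdGaussian, Measure.map_map (by fun_prop) (by fun_prop)]
    rfl
  rw [h1, IsGaussian.map_eq_gaussianReal, integral_strongDual_stdGaussian,
    variance_dual_stdGaussian, gaussianReal_map_const_mul]
  congr 1
  · simp
  · ext; simp

lemma lintegral_exp_sq_gaussianReal {s : ℝ} (hs : 2 * s < 1) :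
    ∫⁻ x, ENNReal.ofReal (Real.exp (s * x ^ 2)) ∂(gaussianReal 0 1)
      = ENNReal.ofReal (1 / √(1 - 2 * s)) := by
  rw [gaussianReal_of_var_ne_zero 0 one_ne_zero,
    lintegral_withDensity_eq_lintegral_mul _ (measurable_gaussianPDF 0 1) (by fun_prop)]
  have h1 : ∀ x : ℝ, (gaussianPDF 0 1 * fun x => ENNReal.ofReal (Real.exp (s * x ^ 2))) x
      = ENNReal.ofReal ((√(2 * Real.pi))⁻¹ * Real.exp (-(1 / 2 - s) * x ^ 2)) := by
    intro x
    rw [Pi.mul_apply, gaussianPDF, ← ENNReal.ofReal_mul (gaussianPDFReal_nonneg _ _ _),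
      gaussianPDFReal]
    congr 1
    simp only [NNReal.coe_one, mul_one, sub_zero]
    rw [mul_assoc, ← Real.exp_add]
    ring_nf
  have hb : 0 < 1 / 2 - s := by linarith
  simp_rw [h1]
  rw [← ofReal_integral_eq_lintegral_ofReal ((integrable_exp_neg_mul_sq hb).const_mul _)
    (Eventually.of_forall fun x => by positivity), integral_const_mul, integral_gaussian]
  congr 1
  rw [← Real.sqrt_inv, ← Real.sqrt_mul (by positivity), one_div (√_), ← Real.sqrt_inv]
  congr 1
  have : 1 - 2 * s ≠ 0 := by linarith
  have := Real.pi_pos.ne'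
  have h2 : (1 / 2 - s) = (1 - 2 * s) / 2 := by ring
  rw [h2]
  field_simp

lemma lintegral_exp_inner_sq {n : ℕ} (a : E n) {s : ℝ} (hs : 2 * (s * ‖a‖ ^ 2) < 1) :
    ∫⁻ q, ENNReal.ofReal (Real.exp (s * (inner ℝ a (WithLp.toLp 2 q)) ^ 2))
        ∂(Measure.pi fun _ : Fin n => gaussianReal 0 1)
      = ENNReal.ofReal (1 / √(1 - 2 * (s * ‖a‖ ^ 2))) := by
  rw [← lintegral_map (f := fun x => ENNReal.ofReal (Real.exp (s * x ^ 2)))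
    (g := fun q : Fin n → ℝ => inner ℝ a (WithLp.toLp 2 q)) (by fun_prop) (by fun_prop),
    map_dotProduct_pi_gaussianReal, lintegral_map (by fun_prop) (by fun_prop),
    ← lintegral_exp_sq_gaussianReal hs]
  simp_rw [mul_pow, mul_assoc]

lemma norm_sq_toEuclideanLin_of {n d : ℕ} (Q : Fin n → Fin d → ℝ) (u : E d) :
    ‖(Matrix.of Q).toEuclideanLin u‖ ^ 2 = ∑ i, (inner ℝ u (WithLp.toLp 2 (Q i))) ^ 2 := by
  rw [EuclideanSpace.norm_sq_eq]
  refine Finset.sum_congr rfl fun i _ => ?_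
  rw [Real.norm_eq_abs, sq_abs]
  simp [Matrix.toLpLin_apply, Matrix.mulVec, dotProduct, PiLp.inner_apply]

/-- The rows of Q are independent, so Qu has n independent N(0, ‖u‖²) coordinates and the
exponential moment factorises. -/
lemma lintegral_exp_norm_sq {n d : ℕ} (u : E d) {s : ℝ} (hs : 2 * (s * ‖u‖ ^ 2) < 1) :
    ∫⁻ Q, ENNReal.ofReal (Real.exp (s * ‖(Matrix.of Q).toEuclideanLin u‖ ^ 2))
        ∂(gaussianMatrix n d)
      = ENNReal.ofReal (1 / √(1 - 2 * (s * ‖u‖ ^ 2))) ^ n := by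
  simp_rw [norm_sq_toEuclideanLin_of, Finset.mul_sum, Real.exp_sum,
    ENNReal.ofReal_prod_of_nonneg fun _ _ => (Real.exp_pos _).le]
  rw [gaussianMatrix, lintegral_prod_eq_prod_lintegral_of_indepFun Finset.univ
    (fun (i : Fin n) (Q : Fin n → Fin d → ℝ) =>
      ENNReal.ofReal (Real.exp (s * (inner ℝ u (WithLp.toLp 2 (Q i))) ^ 2)))
    (iIndepFun_pi (X := fun _ q => ENNReal.ofReal (Real.exp (s * (inner ℝ u (WithLp.toLp 2 q)) ^ 2)))
      fun i => by fun_prop) (fun i => by fun_prop)]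
  rw [Finset.prod_congr rfl fun i _ => ?_, Finset.prod_const, Finset.card_univ, Fintype.card_fin]
  rw [← lintegral_exp_inner_sq u hs]
  exact (measurePreserving_eval (fun _ : Fin n => Measure.pi fun _ : Fin d => gaussianReal 0 1)
    i).lintegral_comp (f := fun q => ENNReal.ofReal (Real.exp (s * (inner ℝ u (WithLp.toLp 2 q)) ^ 2)))
    (by fun_prop)

lemma lintegral_exp_norm_sq_transpose {n d : ℕ} (x : E n) {s : ℝ} (hs : 2 * (s * ‖x‖ ^ 2) < 1) :
    ∫⁻ Q, ENNReal.ofReal (Real.exp (s * ‖(Matrix.of Q)ᵀ.toEuclideanLin x‖ ^ 2))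
        ∂(gaussianMatrix n d)
      = ENNReal.ofReal (1 / √(1 - 2 * (s * ‖x‖ ^ 2))) ^ d := by
  rw [← lintegral_exp_norm_sq (n := d) x hs, ← gaussianMatrix_map_swap n d, lintegral_map]
  · rfl
  · simp_rw [norm_sq_toEuclideanLin_of]
    fun_prop
  · fun_prop

/-- Chernoff's bound for `‖Qᵀx‖²`; the two signs of `s` give the two tails. -/
lemma gaussianMatrix_tail {n d : ℕ} (x : E n) {s r : ℝ} (hs : 2 * (s * ‖x‖ ^ 2) < 1) :
    (gaussianMatrix n d).real {Q | s * r ≤ s * ‖(Matrix.of Q)ᵀ.toEuclideanLin x‖ ^ 2}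
      ≤ Real.exp (-(s * r)) * (1 / √(1 - 2 * (s * ‖x‖ ^ 2))) ^ d := by
  have hm : Measurable fun Q : Fin n → Fin d → ℝ =>
      ENNReal.ofReal (Real.exp (s * ‖(Matrix.of Q)ᵀ.toEuclideanLin x‖ ^ 2)) := by
    have : (fun Q : Fin n → Fin d → ℝ => ‖(Matrix.of Q)ᵀ.toEuclideanLin x‖ ^ 2)
        = fun Q => ∑ i, (inner ℝ x (WithLp.toLp 2 (fun j => Q j i))) ^ 2 := by
      ext Q; exact norm_sq_toEuclideanLin_of (fun j i => Q i j) x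
    have hm' : Measurable fun Q : Fin n → Fin d → ℝ => ‖(Matrix.of Q)ᵀ.toEuclideanLin x‖ ^ 2 := by
      rw [this]; fun_prop
    exact (Real.measurable_exp.comp (hm'.const_mul s)).ennreal_ofReal
  have h := mul_meas_ge_le_lintegral (μ := gaussianMatrix n d) hm
    (ENNReal.ofReal (Real.exp (s * r)))
  rw [lintegral_exp_norm_sq_transpose x hs] at h
  have hset : {Q : Fin n → Fin d → ℝ | ENNReal.ofReal (Real.exp (s * r))
      ≤ ENNReal.ofReal (Real.exp (s * ‖(Matrix.of Q)ᵀ.toEuclideanLin x‖ ^ 2))}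
      = {Q | s * r ≤ s * ‖(Matrix.of Q)ᵀ.toEuclideanLin x‖ ^ 2} := by
    ext Q
    simp only [Set.mem_ofPred_eq]
    rw [ENNReal.ofReal_le_ofReal_iff (Real.exp_pos _).le, Real.exp_le_exp]
  rw [hset, ← ENNReal.ofReal_pow (by positivity)] at h
  have h' := ENNReal.toReal_mono ENNReal.ofReal_ne_top h
  rw [ENNReal.toReal_mul, ENNReal.toReal_ofReal (Real.exp_pos _).le,
    ENNReal.toReal_ofReal (by positivity)] at h'
  rw [Real.exp_neg, inv_mul_eq_div, le_div_iff₀ (Real.exp_pos _), mul_comm]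
  exact h'

lemma gaussianMatrix_upper_tail {n d : ℕ} {x : E n} (hx : x ≠ 0) {δ : ℝ} (hδ : 0 < δ)
    (hδ1 : δ < 1) :
    (gaussianMatrix n d).real {Q | (1 + δ) * d * ‖x‖ ^ 2 ≤ ‖(Matrix.of Q)ᵀ.toEuclideanLin x‖ ^ 2}
      ≤ Real.exp (-(1 / 8) * δ ^ 2 * d) := by
  have hx0 : 0 < ‖x‖ := norm_pos_iff.2 hx
  -- With s‖x‖² = δ/4 the exponent per dimension is -(1+δ)δ/4 + δ/4 + δ²/8 = -δ²/8.
  set s : ℝ := δ / 4 / ‖x‖ ^ 2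
  have hs : 0 < s := by positivity
  have hsx : s * ‖x‖ ^ 2 = δ / 4 := div_mul_cancel₀ _ (by positivity)
  have h := gaussianMatrix_tail (d := d) x (s := s) (r := (1 + δ) * d * ‖x‖ ^ 2)
    (by rw [hsx]; linarith)
  simp only [mul_le_mul_iff_right₀ hs] at h
  refine h.trans ?_
  rw [hsx, show s * ((1 + δ) * d * ‖x‖ ^ 2) = (1 + δ) * d * (s * ‖x‖ ^ 2) by ring, hsx]
  have h1 : Real.exp (-(δ / 2 + δ ^ 2 / 4)) ≤ 1 - 2 * (δ / 4) := by
    rw [Real.exp_neg, inv_le_comm₀ (Real.exp_pos _) (by linarith)]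
    refine le_trans ?_ (Real.quadratic_le_exp_of_nonneg (by positivity))
    rw [inv_le_iff_one_le_mul₀ (by linarith)]
    nlinarith [pow_pos hδ 2, pow_pos hδ 3, mul_pos hδ (sub_pos.2 hδ1),
      mul_pos (pow_pos hδ 2) (sub_pos.2 hδ1), mul_pos (pow_pos hδ 3) (sub_pos.2 hδ1),
      mul_pos (pow_pos hδ 4) (sub_pos.2 hδ1)]
  have h2 : 1 / √(1 - 2 * (δ / 4)) ≤ Real.exp (δ / 4 + δ ^ 2 / 8) := by
    rw [div_le_iff₀ (Real.sqrt_pos.2 (by linarith))]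
    have : Real.exp (-(δ / 4 + δ ^ 2 / 8)) ≤ √(1 - 2 * (δ / 4)) := by
      refine Real.le_sqrt_of_sq_le ?_
      rw [← Real.exp_nat_mul]
      refine le_trans (le_of_eq ?_) h1
      congr 1; push_cast; ring
    calc (1 : ℝ) = Real.exp (δ / 4 + δ ^ 2 / 8) * Real.exp (-(δ / 4 + δ ^ 2 / 8)) := by
          rw [← Real.exp_add]; simp
      _ ≤ _ := by gcongr
  calc _ ≤ Real.exp (-((1 + δ) * d * (δ / 4))) * Real.exp (δ / 4 + δ ^ 2 / 8) ^ d := by gcongr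
    _ = _ := by
      rw [← Real.exp_nat_mul, ← Real.exp_add]
      congr 1; ring

lemma gaussianMatrix_lower_tail {n d : ℕ} {x : E n} (hx : x ≠ 0) {δ : ℝ} (hδ : 0 < δ)
    (hδ1 : δ < 1) :
    (gaussianMatrix n d).real {Q | ‖(Matrix.of Q)ᵀ.toEuclideanLin x‖ ^ 2 ≤ (1 - δ) * d * ‖x‖ ^ 2}
      ≤ Real.exp (-(1 / 8) * δ ^ 2 * d) := by
  have hx0 : 0 < ‖x‖ := norm_pos_iff.2 hx
  -- With s‖x‖² = -δ/2 the exponent per dimension is (1-δ)δ/2 - δ/2 + δ²/4 = -δ²/4, better than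
  -- needed.
  set s : ℝ := -(δ / 2 / ‖x‖ ^ 2)
  have hs : s < 0 := neg_neg_of_pos (by positivity)
  have hsx : s * ‖x‖ ^ 2 = -(δ / 2) := by
    rw [neg_mul, div_mul_cancel₀ _ (by positivity)]
  have h := gaussianMatrix_tail (d := d) x (s := s) (r := (1 - δ) * d * ‖x‖ ^ 2)
    (by rw [hsx]; linarith)
  simp only [mul_le_mul_left_of_neg hs] at h
  refine h.trans ?_
  rw [hsx, show s * ((1 - δ) * d * ‖x‖ ^ 2) = (1 - δ) * d * (s * ‖x‖ ^ 2) by ring, hsx]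
  have h1 : Real.exp (δ - δ ^ 2 / 2) ≤ 1 - 2 * -(δ / 2) := by
    rw [show 1 - 2 * -(δ / 2) = 1 + δ by ring, ← Real.le_log_iff_exp_le (by linarith)]
    refine le_trans ?_ (Real.le_log_one_add_of_nonneg hδ.le)
    rw [le_div_iff₀ (by linarith)]
    nlinarith [pow_pos hδ 3]
  have h2 : 1 / √(1 - 2 * -(δ / 2)) ≤ Real.exp (-(δ / 2 - δ ^ 2 / 4)) := by
    rw [div_le_iff₀ (Real.sqrt_pos.2 (by linarith))]
    have : Real.exp (δ / 2 - δ ^ 2 / 4) ≤ √(1 - 2 * -(δ / 2)) := by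
      refine Real.le_sqrt_of_sq_le ?_
      rw [← Real.exp_nat_mul]
      refine le_trans (le_of_eq ?_) h1
      congr 1; push_cast; ring
    calc (1 : ℝ) = Real.exp (-(δ / 2 - δ ^ 2 / 4)) * Real.exp (δ / 2 - δ ^ 2 / 4) := by
          rw [← Real.exp_add]; simp
      _ ≤ _ := by gcongr
  calc _ ≤ Real.exp (-((1 - δ) * d * -(δ / 2))) * Real.exp (-(δ / 2 - δ ^ 2 / 4)) ^ d := by gcongr
    _ = Real.exp (-(1 / 4) * δ ^ 2 * d) := by
      rw [← Real.exp_nat_mul, ← Real.exp_add]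
      congr 1; ring
    _ ≤ _ := by
      gcongr
      nlinarith [sq_nonneg δ]

lemma gaussianMatrix_fiftieth_tail {n d : ℕ} (hd : 1 ≤ d) {x : E n} (hx : x ≠ 0) :
    (gaussianMatrix n d).real {Q | ‖(Matrix.of Q)ᵀ.toEuclideanLin x‖ ^ 2 ≤ d / 50 * ‖x‖ ^ 2}
      ≤ 0.2332 := by
  have hx0 : 0 < ‖x‖ := norm_pos_iff.2 hx
  -- The Chernoff bound at level 1/50 is optimal where 1 - 2s‖x‖² = 50. Its value is
  -- (e^{0.49}/√50)^d, and d = 1 is the worst case.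
  set s : ℝ := -(49 / 2 / ‖x‖ ^ 2)
  have hs : s < 0 := neg_neg_of_pos (by positivity)
  have hsx : s * ‖x‖ ^ 2 = -(49 / 2) := by
    rw [neg_mul, div_mul_cancel₀ _ (by positivity)]
  have h := gaussianMatrix_tail (d := d) x (s := s) (r := d / 50 * ‖x‖ ^ 2)
    (by rw [hsx]; linarith)
  simp only [mul_le_mul_left_of_neg hs] at h
  refine h.trans ?_
  rw [hsx, show s * (d / 50 * ‖x‖ ^ 2) = d / 50 * (s * ‖x‖ ^ 2) by ring, hsx,
    show (1 : ℝ) - 2 * -(49 / 2) = 50 by norm_num,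
    show -((d : ℝ) / 50 * -(49 / 2)) = d * (49 / 100) by ring, Real.exp_nat_mul, ← mul_pow]
  have hq : Real.exp (49 / 100) * (1 / √50) ≤ 0.2332 := by
    refine abs_le_of_sq_le_sq' ?_ (by norm_num) |>.2
    rw [mul_pow, div_pow, Real.sq_sqrt (by norm_num), ← Real.exp_nat_mul]
    have h1 : Real.exp ((2 : ℕ) * (49 / 100)) ≤ Real.exp 1 := Real.exp_le_exp.2 (by norm_num)
    have := Real.exp_one_lt_d9
    norm_num1 at h1 ⊢
    linarith
  exact (pow_le_of_le_one (by positivity) (hq.trans (by norm_num)) (by omega)).trans hq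

/-! ### The operator norm -/

/-- The reflection w ↦ 2u - w preserves volume and the ball around u. As Au is the midpoint of Aw
and A(2u - w), at least one of the two images is as long as Au, so the set and its reflection cover
the ball. -/
lemma half_volume_ball_le {n d : ℕ} (A : E d →ₗ[ℝ] E n) (u : E d) :
    volume (Metric.ball (0 : E d) 1)
      ≤ 2 * volume (Metric.ball u 1 ∩ {w | ‖A u‖ ^ 2 ≤ ‖A w‖ ^ 2}) := by
  set s := Metric.ball u 1 ∩ {w | ‖A u‖ ^ 2 ≤ ‖A w‖ ^ 2} with hs
  have hA : Continuous A := A.continuous_of_finiteDimensional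
  have hms : MeasurableSet s := Metric.isOpen_ball.measurableSet.inter
    (measurableSet_le measurable_const (hA.norm.pow 2).measurable)
  have hmp := Measure.measurePreserving_sub_left (volume : Measure (E d)) ((2 : ℝ) • u)
  have hsub : Metric.ball u 1 ⊆ s ∪ (fun w => (2 : ℝ) • u - w) ⁻¹' s := by
    intro w hw
    by_cases h : ‖A u‖ ^ 2 ≤ ‖A w‖ ^ 2
    · exact Or.inl ⟨hw, h⟩
    · refine Or.inr ⟨?_, ?_⟩
      · rw [Metric.mem_ball, dist_eq_norm] at hw ⊢
        rw [← norm_neg]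
        rwa [show -((2 : ℝ) • u - w - u) = w - u by module]
      · have h1 : (2 : ℝ) • A u = A w + A ((2 : ℝ) • u - w) := by
          rw [map_sub, map_smul]; abel
        have h2 : 2 * ‖A u‖ ≤ ‖A w‖ + ‖A ((2 : ℝ) • u - w)‖ := by
          have := norm_add_le (A w) (A ((2 : ℝ) • u - w))
          rwa [← h1, norm_smul, Real.norm_ofNat] at this
        have h3 : ‖A w‖ < ‖A u‖ := lt_of_pow_lt_pow_left₀ 2 (norm_nonneg _) (not_le.1 h)
        exact pow_le_pow_left₀ (norm_nonneg _) (by linarith) 2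
  calc volume (Metric.ball (0 : E d) 1) = volume (Metric.ball u 1) :=
        (Measure.addHaar_ball_center volume u 1).symm
    _ ≤ volume s + volume ((fun w => (2 : ℝ) • u - w) ⁻¹' s) :=
        (measure_mono hsub).trans (measure_union_le _ _)
    _ = 2 * volume s := by rw [hmp.measure_preimage hms.nullMeasurableSet, two_mul]

lemma measurable_norm_sq_toEuclideanLin_of (n d : ℕ) :
    Measurable fun p : (Fin n → Fin d → ℝ) × E d => ‖(Matrix.of p.1).toEuclideanLin p.2‖ ^ 2 := by
  simp_rw [norm_sq_toEuclideanLin_of, PiLp.inner_apply]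
  fun_prop

/-- The complement of `{Q | ‖Q‖² ≤ T}` is a rare event. -/
lemma gaussianMatrix_norm_tail (n d : ℕ) (T : ℝ) :
    (gaussianMatrix n d).real {Q | ∀ v, ‖(Matrix.of Q).toEuclideanLin v‖ ^ 2 ≤ T * ‖v‖ ^ 2}ᶜ
      ≤ 2 * 2 ^ d * √2 ^ n * Real.exp (-(T / 16)) := by
  set B := Metric.ball (0 : E d) 1
  -- If ‖Qu‖² ≥ T at a unit vector u, then half of the unit ball around u contributes e^{T/16} to
  -- the integral of `G Q` over the ball of radius 2. With the factor 1/16 the Gaussian moment there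
  -- is at most √2ⁿ, since 2·(1/16)·2² = 1/2. Markov's inequality concludes.
  set G : (Fin n → Fin d → ℝ) → E d → ℝ≥0∞ := fun Q w =>
    ENNReal.ofReal (Real.exp (1 / 16 * ‖(Matrix.of Q).toEuclideanLin w‖ ^ 2)) with hG
  have hGm : Measurable (Function.uncurry G) :=
    (Real.measurable_exp.comp
      ((measurable_norm_sq_toEuclideanLin_of n d).const_mul (1 / 16))).ennreal_ofReal
  have hGQ : ∀ Q, Measurable (G Q) := fun Q => hGm.of_uncurry_left
  set F : (Fin n → Fin d → ℝ) → ℝ≥0∞ := fun Q => ∫⁻ w in Metric.ball 0 2, G Q w with hF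
  have hFm : Measurable F := hGm.lintegral_prod_right'
  have hlow : ∀ Q ∈ {Q | ∀ v, ‖(Matrix.of Q).toEuclideanLin v‖ ^ 2 ≤ T * ‖v‖ ^ 2}ᶜ,
      ENNReal.ofReal (Real.exp (T / 16)) * (volume B / 2) ≤ F Q := by
    intro Q hQ
    simp only [Set.mem_compl_iff, Set.mem_ofPred_eq, not_forall, not_le] at hQ
    obtain ⟨v, hv⟩ := hQ
    have hv0 : v ≠ 0 := by rintro rfl; simp at hv
    have hvpos : 0 < ‖v‖ := norm_pos_iff.2 hv0
    set u := ‖v‖⁻¹ • v with hu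
    have hun : ‖u‖ = 1 := by rw [hu, norm_smul, norm_inv, norm_norm, inv_mul_cancel₀ hvpos.ne']
    have huT : T ≤ ‖(Matrix.of Q).toEuclideanLin u‖ ^ 2 := by
      rw [hu, map_smul, norm_smul, norm_inv, norm_norm, mul_pow, inv_pow, inv_mul_eq_div,
        le_div_iff₀ (by positivity)]
      exact hv.le
    set s := Metric.ball u 1 ∩ {w | ‖(Matrix.of Q).toEuclideanLin u‖ ^ 2
      ≤ ‖(Matrix.of Q).toEuclideanLin w‖ ^ 2} with hs
    have hvol := half_volume_ball_le (Matrix.of Q).toEuclideanLin u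
    have hsub : s ⊆ Metric.ball 0 2 := by
      refine Set.inter_subset_left.trans (Metric.ball_subset_ball' ?_)
      rw [dist_zero_right, hun]; norm_num
    calc ENNReal.ofReal (Real.exp (T / 16)) * (volume B / 2)
        ≤ ENNReal.ofReal (Real.exp (T / 16)) * volume s := by
          gcongr
          exact ENNReal.div_le_of_le_mul' hvol
      _ = ∫⁻ _ in s, ENNReal.ofReal (Real.exp (T / 16)) := by rw [setLIntegral_const]
      _ ≤ ∫⁻ w in s, G Q w := by
          refine setLIntegral_mono (hGQ Q) fun w hw => ?_
          refine ENNReal.ofReal_le_ofReal (Real.exp_le_exp.2 ?_)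
          have := hw.2
          simp only [Set.mem_ofPred_eq] at this
          linarith
      _ ≤ F Q := lintegral_mono_set hsub
  have hup : ∫⁻ Q, F Q ∂(gaussianMatrix n d)
      ≤ ENNReal.ofReal (√2) ^ n * (ENNReal.ofReal (2 ^ d) * volume B) := by
    rw [hF, lintegral_lintegral_swap (hGm.aemeasurable)]
    calc _ ≤ ∫⁻ w in Metric.ball (0 : E d) 2, ENNReal.ofReal (√2) ^ n := by
          refine setLIntegral_mono measurable_const fun w hw => ?_
          rw [mem_ball_zero_iff] at hw
          have hw2 : ‖w‖ ^ 2 ≤ 4 := by nlinarith [norm_nonneg w]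
          rw [lintegral_exp_norm_sq w (by linarith)]
          gcongr
          rw [div_le_iff₀ (Real.sqrt_pos.2 (by linarith)), ← Real.sqrt_mul (by norm_num)]
          refine Real.le_sqrt_of_sq_le ?_
          linarith
      _ = _ := by
          rw [setLIntegral_const, Measure.addHaar_ball_of_pos volume _ (by norm_num)]
          simp [B]
  have hB0 : volume B ≠ 0 := (Metric.measure_ball_pos volume 0 one_pos).ne'
  have hBt : volume B ≠ ⊤ := measure_ball_lt_top.ne
  have h := (mul_le_mul_right (measure_mono (μ := gaussianMatrix n d) hlow)
    (ENNReal.ofReal (Real.exp (T / 16)) * (volume B / 2))).trans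
    ((mul_meas_ge_le_lintegral (μ := gaussianMatrix n d) hFm
    (ENNReal.ofReal (Real.exp (T / 16)) * (volume B / 2))).trans hup)
  have h' := ENNReal.toReal_mono (by finiteness) h
  simp only [ENNReal.toReal_mul, ENNReal.toReal_div, ENNReal.toReal_pow,
    ENNReal.toReal_ofReal (Real.exp_pos _).le, ENNReal.toReal_ofReal (Real.sqrt_nonneg _),
    ENNReal.toReal_ofReal (by positivity : (0 : ℝ) ≤ 2 ^ d), ENNReal.toReal_ofNat] at h'
  have hBr : 0 < (volume B).toReal := ENNReal.toReal_pos hB0 hBt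
  rw [Real.exp_neg, ← div_eq_mul_inv, le_div_iff₀ (Real.exp_pos _)]
  refine le_of_mul_le_mul_right ?_ (half_pos hBr)
  rw [Measure.real]
  linarith

lemma gaussianMatrix_norm_tail_le (n d : ℕ) :
    (gaussianMatrix n d).real
        {Q | ∀ v, ‖(Matrix.of Q).toEuclideanLin v‖ ^ 2 ≤ 48 * (n + d) * ‖v‖ ^ 2}ᶜ
      ≤ 2 * Real.exp (-(n + d)) := by
  refine (gaussianMatrix_norm_tail n d _).trans ?_
  have h2 : (2 : ℝ) ≤ Real.exp 1 := by have := Real.exp_one_gt_d9; linarith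
  have h3 : √2 ≤ Real.exp 1 := by
    refine le_trans ?_ h2
    rw [Real.sqrt_le_left (by norm_num)]; norm_num
  -- The constant 48 makes the exponent -3(n+d), of which n+d is spent on the factors 2^d and √2ⁿ.
  calc 2 * 2 ^ d * √2 ^ n * Real.exp (-(48 * (n + d) / 16))
      ≤ 2 * Real.exp 1 ^ d * Real.exp 1 ^ n * Real.exp (-(48 * (n + d) / 16)) := by gcongr
    _ = 2 * Real.exp (-(2 * (n + d))) := by
        rw [← Real.exp_nat_mul, ← Real.exp_nat_mul, mul_assoc, mul_assoc, ← Real.exp_add,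
          ← Real.exp_add]
        congr 2; ring
    _ ≤ _ := by
        gcongr
        have : (0 : ℝ) ≤ n + d := by positivity
        linarith

/-! ### Existence of the constants -/

lemma one_sub_le_of_compl {α : Type*} [MeasurableSpace α] {μ : Measure α} [IsProbabilityMeasure μ]
    {s : Set α} {q : ℝ} (h : μ.real sᶜ ≤ q) : 1 - q ≤ μ.real s := by
  have h1 := measureReal_union_le (μ := μ) s sᶜ
  rw [Set.union_compl_self, probReal_univ] at h1
  linarith

lemma norm_sq_inv_sqrt_smul {r : ℕ} {d : ℕ} (v : E r) :
    ‖(1 / √(d : ℝ)) • v‖ ^ 2 = ‖v‖ ^ 2 / d := by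
  rw [norm_smul, mul_pow, Real.norm_eq_abs, sq_abs, div_pow, Real.sq_sqrt (by positivity)]
  ring

lemma isVectorNormConst_eighth {n d : ℕ} (hd : 1 ≤ d) : IsVectorNormConst n d (1 / 8) := by
  refine ⟨by norm_num, fun δ hδ hδ1 x => ?_⟩
  have hd0 : (0 : ℝ) < d := by exact_mod_cast hd
  rcases eq_or_ne x 0 with rfl | hx
  · have := Real.exp_pos (-(1 / 8) * δ ^ 2 * d)
    simp; positivity
  apply one_sub_le_of_compl
  refine (measureReal_mono (s₂ := {Q | (1 + δ) * d * ‖x‖ ^ 2 ≤ ‖(Matrix.of Q)ᵀ.toEuclideanLin x‖ ^ 2}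
    ∪ {Q | ‖(Matrix.of Q)ᵀ.toEuclideanLin x‖ ^ 2 ≤ (1 - δ) * d * ‖x‖ ^ 2}) ?_).trans ?_
  · intro Q hQ
    simp only [norm_sq_inv_sqrt_smul, Set.mem_compl_iff, Set.mem_ofPred_eq, not_and_or, not_le,
      lt_div_iff₀ hd0, div_lt_iff₀ hd0] at hQ
    rcases hQ with hQ | hQ
    · right
      simp only [Set.mem_ofPred_eq]
      linarith
    · left
      simp only [Set.mem_ofPred_eq]
      linarith
  · refine (measureReal_union_le _ _).trans ?_
    have h1 := gaussianMatrix_upper_tail (d := d) hx hδ hδ1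
    have h2 := gaussianMatrix_lower_tail (d := d) hx hδ hδ1
    linarith

lemma isOpNormConst_of_le {n d : ℕ} (hd : 1 ≤ d) (hdn : d ≤ n) : IsOpNormConst n d 96 := by
  refine ⟨by norm_num, ?_⟩
  have hd0 : (0 : ℝ) < d := by exact_mod_cast hd
  have hdn' : (d : ℝ) ≤ n := by exact_mod_cast hdn
  apply one_sub_le_of_compl
  refine le_trans (measureReal_mono (Set.compl_subset_compl.2 ?_))
    ((gaussianMatrix_norm_tail_le n d).trans ?_)
  · intro Q hQ
    have := opNorm_mul_transpose_le (Matrix.of Q) (N := 48 * (n + d)) (by positivity) hQ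
    simp only [Set.mem_ofPred_eq]
    rw [one_div, inv_mul_le_iff₀ hd0]
    have h2 : (d : ℝ) * (96 * (n / d)) = 96 * n := by field_simp
    rw [h2]
    linarith
  · gcongr
    linarith

end Gaussian

/-! ### Measurability of the iterates and independence of the next sample. -/

section Measurability

variable {α : Type*} [MeasurableSpace α] {n m d : ℕ} {f : E n → ℝ}

lemma measurable_toEuclideanLin {r : ℕ} {A : α → Matrix (Fin n) (Fin r) ℝ} {v : α → E r}
    (hA : ∀ i j, Measurable fun a => A a i j) (hv : Measurable v) :
    Measurable fun a => (A a).toEuclideanLin (v a) := by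
  have h : Measurable fun a => WithLp.toLp 2 fun i => ∑ j, A a i j * v a j := by fun_prop
  exact h

lemma measurable_toLp_col {r : ℕ} {A : α → Matrix (Fin n) (Fin r) ℝ}
    (hA : ∀ i j, Measurable fun a => A a i j) (j : Fin r) :
    Measurable fun a => (WithLp.toLp 2 ((A a).col j) : E n) := by
  have h : Measurable fun a => WithLp.toLp 2 fun i => A a i j := by fun_prop
  exact h

lemma measurable_fdGrad {r : ℕ} (hf : Continuous f) {A : α → Matrix (Fin n) (Fin r) ℝ} {x : α → E n}
    (hA : ∀ i j, Measurable fun a => A a i j) (hx : Measurable x) (ε : ℝ) :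
    Measurable fun a => fdGrad f (A a) ε (x a) := by
  have h1 := fun j => measurable_toLp_col hA j
  have hf' := hf.measurable
  unfold fdGrad
  fun_prop

lemma measurable_unitVec {v : α → E n} (hv : Measurable v) : Measurable fun a => unitVec (v a) := by
  unfold unitVec; fun_prop

lemma measurable_updateP {P : α → Matrix (Fin n) (Fin m) ℝ} {x w : α → E n}
    (hP : ∀ i j, Measurable fun a => P a i j) (hx : Measurable x) (hw : Measurable w) (i : Fin n)
    (j : Fin m) : Measurable fun a => updateP (P a) (x a) (w a) i j := by
  have h1 := measurable_unitVec hx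
  have h2 := measurable_unitVec hw
  simp only [updateP, Matrix.of_apply]
  split_ifs
  · exact hP _ _
  · fun_prop
  · fun_prop

lemma measurable_bfgs {H : α → Matrix (Fin m) (Fin m) ℝ} {s y : α → Fin m → ℝ}
    (hH : ∀ i j, Measurable fun a => H a i j) (hs : Measurable s) (hy : Measurable y)
    (i j : Fin m) : Measurable fun a => bfgs (H a) (s a) (y a) i j := by
  simp only [bfgs, Matrix.add_apply, Matrix.mul_apply, Matrix.sub_apply, Matrix.smul_apply,
    Matrix.vecMulVec_apply, smul_eq_mul, dotProduct]
  fun_prop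

lemma measurable_backtrack (β : ℝ) {p : α → ℝ → Prop}
    (hp : ∀ t, MeasurableSet {a | p a t}) : Measurable fun a => backtrack β (p a) := by
  classical
  -- Declaring every index acceptable when the search fails makes `Nat.find` total; the value 0 is
  -- restored by cases afterwards.
  let q : ℕ → α → Prop := fun i a => p a (β ^ i) ∨ ∀ j, ¬ p a (β ^ j)
  have hall : MeasurableSet {a | ∀ j, ¬ p a (β ^ j)} := by
    have : {a | ∀ j : ℕ, ¬ p a (β ^ j)} = ⋂ j : ℕ, {a | p a (β ^ j)}ᶜ := by ext; simp
    rw [this]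
    exact MeasurableSet.iInter fun j => (hp _).compl
  have hq : ∀ i, MeasurableSet {a | q i a} := fun i => (hp _).union hall
  have hex : ∀ a, ∃ i, q i a := by
    intro a
    by_cases h : ∃ i : ℕ, p a (β ^ i)
    · exact h.imp fun i hi => Or.inl hi
    · exact ⟨0, Or.inr (not_exists.1 h)⟩
  have hm : Measurable fun a => β ^ Nat.find (hex a) :=
    Measurable.find (f := fun i (_ : α) => β ^ i) (fun i => measurable_const) hq hex
  have heq : (fun a => backtrack β (p a))
      = fun a => if ∀ j : ℕ, ¬ p a (β ^ j) then 0 else β ^ Nat.find (hex a) := by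
    ext a
    by_cases h : ∃ i : ℕ, p a (β ^ i)
    · have h' : ¬ ∀ j : ℕ, ¬ p a (β ^ j) := by push Not; exact h
      rw [if_neg h', backtrack, dif_pos h]
      congr 1
      refine Nat.find_congr' fun {i} => ?_
      simp only [q, h', or_false]
    · rw [if_pos (not_exists.1 h), backtrack, dif_neg h]
  rw [heq]
  exact Measurable.ite hall measurable_const hm

open scoped Matrix.Norms.L2Operator in
lemma continuousOn_modifyEig (M₁ M₂ : ℝ) :
    ContinuousOn (modifyEig M₁ M₂ : Matrix (Fin m) (Fin m) ℝ → _) {A | A.IsHermitian} := by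
  refine ContinuousOn.cfc_of_mem_nhdsSet (s := Set.univ) _ (by simp) continuousOn_id
    (fun A hA => hA) ?_
  fun_prop

/-- Clipping eigenvalues is continuous on Hermitian matrices, so it is composed with the measurable
map into that subtype. -/
lemma measurable_modifyEig (M₁ M₂ : ℝ) {A : α → Matrix (Fin m) (Fin m) ℝ}
    (hA : ∀ i j, Measurable fun a => A a i j) (hs : ∀ a, (A a).IsHermitian) (i j : Fin m) :
    Measurable fun a => modifyEig M₁ M₂ (A a) i j := by
  have h1 : Continuous fun B : {B : Fin m → Fin m → ℝ // (Matrix.of B).IsHermitian} =>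
      modifyEig M₁ M₂ (Matrix.of B.1) i j := by
    have h := (continuousOn_modifyEig (m := m) M₁ M₂).comp_continuous
      (f := fun B : {B : Fin m → Fin m → ℝ // (Matrix.of B).IsHermitian} => Matrix.of B.1)
      (by exact continuous_subtype_val) (fun B => B.2)
    exact h.matrix_elem i j
  have h2 : Measurable fun a => (⟨A a, hs a⟩ :
      {B : Fin m → Fin m → ℝ // (Matrix.of B).IsHermitian}) := by
    refine Measurable.subtype_mk ?_
    exact measurable_pi_lambda _ fun i => measurable_pi_lambda _ fun j => hA i j
  exact h1.measurable.comp h2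

/-- Measurability of the iterate, of the subspace matrix and of the inverse Hessian approximation. -/
def MeasurableState (S : α → State n m) : Prop :=
  (Measurable fun a => (S a).x) ∧ (∀ i j, Measurable fun a => (S a).P i j) ∧
    ∀ i j, Measurable fun a => (S a).H i j

variable {β c M₁ M₂ : ℝ}

lemma MeasurableState.step (hf : Continuous f) {S : α → State n m} (hS : MeasurableState S)
    (hH : ∀ a, (S a).H.IsHermitian) {Q : α → Matrix (Fin n) (Fin d) ℝ}
    (hQ : ∀ i j, Measurable fun a => Q a i j) (ε : ℝ) :
    MeasurableState fun a => step f β c M₁ M₂ ε (Q a) (S a) := by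
  obtain ⟨hx, hP, hSH⟩ := hS
  have hw := measurable_toEuclideanLin hQ (measurable_fdGrad hf hQ hx ε)
  have hP' := measurable_updateP hP hx hw
  have hh := measurable_fdGrad hf hP' hx ε
  have hdir := (measurable_toEuclideanLin hSH hh).neg
  have hPd := measurable_toEuclideanLin hP' hdir
  have hdot := Finset.univ.measurable_sum (fun i _ =>
    (measurable_pi_apply (i : Fin m)).comp ((WithLp.measurable_ofLp 2 _).comp hh) |>.mul
    ((measurable_pi_apply (i : Fin m)).comp ((WithLp.measurable_ofLp 2 _).comp hdir)))
  have hα := measurable_backtrack (α := α) β (p := fun a t =>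
      f ((S a).x + t • (updateP (S a).P (S a).x
        ((Q a).toEuclideanLin (fdGrad f (Q a) ε (S a).x))).toEuclideanLin
        (-((S a).H.toEuclideanLin (fdGrad f (updateP (S a).P (S a).x
        ((Q a).toEuclideanLin (fdGrad f (Q a) ε (S a).x))) ε (S a).x))))
      ≤ f (S a).x + c * t * ((fdGrad f (updateP (S a).P (S a).x
        ((Q a).toEuclideanLin (fdGrad f (Q a) ε (S a).x))) ε (S a).x).ofLp ⬝ᵥ
        (-((S a).H.toEuclideanLin (fdGrad f (updateP (S a).P (S a).x
        ((Q a).toEuclideanLin (fdGrad f (Q a) ε (S a).x))) ε (S a).x))).ofLp))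
    (fun t => measurableSet_le (hf.measurable.comp (hx.add (hPd.const_smul t)))
      ((hf.measurable.comp hx).add (hdot.const_mul _)))
  have hx' := hx.add (hα.smul hPd)
  refine ⟨hx', hP', ?_⟩
  refine measurable_modifyEig M₁ M₂ (measurable_bfgs hSH ?_ ?_)
    (fun a => isHermitian_bfgs (hH a) _ _)
  · exact (WithLp.measurable_ofLp 2 _).comp (hα.smul hdir)
  · exact (WithLp.measurable_ofLp 2 _).comp ((measurable_fdGrad hf hP' hx' ε).sub hh)

lemma measurableState_run (hf : Continuous f) (hm : 2 ≤ m) {S₀ : State n m}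
    (hS₀ : Admissible M₁ M₂ S₀) (ε : ℕ → ℝ) (k : ℕ) :
    MeasurableState fun q : ℕ → Fin n → Fin d → ℝ =>
      run f β c M₁ M₂ ε (fun j => Matrix.of (q j)) S₀ k := by
  induction k with
  | zero =>
    simp only [run]
    exact ⟨measurable_const, fun _ _ => measurable_const, fun _ _ => measurable_const⟩
  | succ k ih =>
    refine ih.step hf (fun q => (hS₀.run hm _ _ k).2.isHermitian) (fun i j => ?_) (ε k)
    simp only [Matrix.of_apply]
    fun_prop

lemma run_congr {Q Q' : ℕ → Matrix (Fin n) (Fin d) ℝ} (ε : ℕ → ℝ) (S₀ : State n m) {k : ℕ}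
    (h : ∀ j < k, Q j = Q' j) : run f β c M₁ M₂ ε Q S₀ k = run f β c M₁ M₂ ε Q' S₀ k := by
  induction k with
  | zero => rfl
  | succ k ih =>
    rw [run, run, ih fun j hj => h j (by omega), h k (by omega)]

/-- The iterate `x_k` is independent of the matrix `Q_k` sampled next. -/
lemma indepFun_run {Ω : Type*} [MeasurableSpace Ω] {μ : Measure Ω} (hf : Continuous f)
    (hm : 2 ≤ m) {S₀ : State n m} (hS₀ : Admissible M₁ M₂ S₀) (ε : ℕ → ℝ)
    {Q : ℕ → Ω → Fin n → Fin d → ℝ} (hQm : ∀ k, Measurable (Q k)) (hQ : iIndepFun Q μ) (k : ℕ) :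
    IndepFun (fun ω => (run f β c M₁ M₂ ε (fun j => Matrix.of (Q j ω)) S₀ k).x) (Q k) μ := by
  have h := hQ.indepFun_finset (Finset.range k) {k} (by simp) hQm
  -- The state before iteration k reads only the samples before k, so padding them by 0 exhibits x_k
  -- as a function of those samples.
  let ext : (Finset.range k → Fin n → Fin d → ℝ) → ℕ → Fin n → Fin d → ℝ :=
    fun q j => if hj : j ∈ Finset.range k then q ⟨j, hj⟩ else 0
  have hext : Measurable ext := by
    refine measurable_pi_lambda _ fun j => ?_
    by_cases hj : j ∈ Finset.range k
    · simp only [ext, dif_pos hj]; exact measurable_pi_apply _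
    · simp only [ext, dif_neg hj]; exact measurable_const
  have hψ : Measurable fun q : ({k} : Finset ℕ) → Fin n → Fin d → ℝ => q ⟨k, by simp⟩ :=
    measurable_pi_apply _
  have h1 := h.comp (φ := fun q => (run f β c M₁ M₂ ε (fun j => Matrix.of (ext q j)) S₀ k).x)
    ((measurableState_run hf hm hS₀ ε k).1.comp hext) hψ
  have hrun : (fun ω => (run f β c M₁ M₂ ε (fun j => Matrix.of (Q j ω)) S₀ k).x)
      = fun ω => (run f β c M₁ M₂ ε (fun j => Matrix.of (ext (fun i => Q i ω) j)) S₀ k).x := by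
    ext1 ω
    congr 1
    refine run_congr ε S₀ fun j hj => ?_
    simp [ext, hj]
  rw [hrun]
  exact h1

lemma measurable_run {Ω : Type*} [MeasurableSpace Ω] (hf : Continuous f)
    (hm : 2 ≤ m) {S₀ : State n m} (hS₀ : Admissible M₁ M₂ S₀) (ε : ℕ → ℝ)
    {Q : ℕ → Ω → Fin n → Fin d → ℝ} (hQm : ∀ k, Measurable (Q k)) (k : ℕ) :
    Measurable fun ω => (run f β c M₁ M₂ ε (fun j => Matrix.of (Q j ω)) S₀ k).x :=
  (measurableState_run hf hm hS₀ ε k).1.comp (measurable_pi_lambda (fun ω j => Q j ω) hQm)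

end Measurability

/-! ### Deterministic recursions with quadratic decrease. -/

section Recursions

lemma le_one_div_of_quadratic_decrease {D : ℕ → ℝ} {b S τ : ℝ} (hb : 0 ≤ b) (hS : 0 < S)
    (h0 : D 0 - τ ≤ 1 / S) (hD : ∀ k, D (k + 1) ≤ D k - b * (max (D k - τ) 0) ^ 2) (k : ℕ) :
    D k ≤ 1 / (S + b * k) + τ := by
  induction k with
  | zero => simpa using (by linarith : D 0 ≤ 1 / S + τ)
  | succ k ih =>
    have h := hD k
    set u := D k - τ with hu
    have hT : 0 < S + b * k := by positivity
    have hT' : 0 < S + b * (k + 1 : ℕ) := by positivity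
    rcases le_or_gt u 0 with hneg | hpos
    · rw [max_eq_right hneg] at h
      have : 0 < 1 / (S + b * (k + 1 : ℕ)) := by positivity
      linarith
    · rw [max_eq_left hpos.le] at h
      have huT : u * (S + b * k) ≤ 1 := by
        rw [← le_div_iff₀ hT]; linarith
      suffices u - b * u ^ 2 ≤ 1 / (S + b * (k + 1 : ℕ)) by linarith
      rw [le_div_iff₀ hT']
      push_cast
      -- With u(S+bk) ≤ 1 the product is at most (1-bu)(1+bu) ≤ 1 if bu ≤ 1, and nonpositive
      -- otherwise. This avoids dividing by u.
      have hfac : (u - b * u ^ 2) * (S + b * (k + 1))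
          = (1 - b * u) * (u * (S + b * k) + b * u) := by ring
      rw [hfac]
      rcases le_or_gt (b * u) 1 with h1 | h1
      · nlinarith [sq_nonneg (b * u)]
      · have : 0 ≤ u * (S + b * k) + b * u := by positivity
        nlinarith

lemma le_div_of_quadratic_decrease {D : ℕ → ℝ} {b B : ℝ} (hb : 0 < b)
    {τ : ℕ → ℝ} (hτ : ∀ k, τ k ≤ B / (k + 1))
    (hD : ∀ k, D (k + 1) ≤ D k - b * (max (D k - τ k) 0) ^ 2) (k : ℕ) :
    D k ≤ max (max (4 * B) (16 / b)) (D 0) / (k + 1) := by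
  set M := max (max (4 * B) (16 / b)) (D 0) with hM
  have hM1 : 4 * B ≤ M := (le_max_left _ _).trans (le_max_left _ _)
  have hM2 : 16 / b ≤ M := (le_max_right _ _).trans (le_max_left _ _)
  have hM0 : 0 < M := lt_of_lt_of_le (by positivity) hM2
  rw [div_le_iff₀ hb] at hM2
  induction k with
  | zero => simp [hM]
  | succ k ih =>
    have h := hD k
    push_cast
    have hk : (0 : ℝ) < k + 1 := by positivity
    have hk2 : (0 : ℝ) < k + 1 + 1 := by positivity
    -- If D_k is already below the next bound, monotonicity suffices. Otherwise D_k > M/(2(k+1)) or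
    -- equals it, while τ_k ≤ M/(4(k+1)), so the decrease is at least bM²/(16(k+1)²); by bM ≥ 16
    -- this covers M/(k+1) - M/(k+2).
    rcases le_or_gt (D k) (M / (k + 1 + 1)) with hle | hgt
    · have : 0 ≤ b * (max (D k - τ k) 0) ^ 2 := by positivity
      linarith
    · have h1 : M / (2 * (k + 1)) ≤ M / (k + 1 + 1) := by
        gcongr
        have : (0 : ℝ) ≤ k := by positivity
        linarith
      have h2 : B / (k + 1) ≤ M / (4 * (k + 1)) := by
        rw [div_le_div_iff₀ hk (by positivity)]
        nlinarith
      have h3 : M / (4 * (k + 1)) ≤ max (D k - τ k) 0 := by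
        refine le_trans ?_ (le_max_left _ _)
        have h4 : M / (2 * (k + 1)) = M / (4 * (k + 1)) + M / (4 * (k + 1)) := by
          field_simp; ring
        linarith [hτ k]
      have h5 : b * (M / (4 * (k + 1))) ^ 2 ≤ b * (max (D k - τ k) 0) ^ 2 := by gcongr
      have h6 : M / ((k + 1) * (k + 1 + 1)) ≤ b * (M / (4 * (k + 1))) ^ 2 := by
        rw [div_pow, mul_div_assoc', div_le_div_iff₀ (by positivity) (by positivity)]
        have e1 : M * (4 * (k + 1 : ℝ)) ^ 2 = 16 * (M * (k + 1) * (k + 1)) := by ring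
        have e2 : b * M ^ 2 * ((k + 1) * (k + 1 + 1) : ℝ)
            = M * b * (M * (k + 1) * (k + 1 + 1)) := by ring
        rw [e1, e2]
        gcongr
        linarith
      have h7 : M / (k + 1 : ℝ) - M / ((k + 1) * (k + 1 + 1)) = M / (k + 1 + 1) := by
        field_simp; ring
      linarith

/-- The finitely many terms not controlled by the asymptotics are absorbed in the sum; from k ≥ 1
on, k+1 ≤ 2k. -/
lemma exists_le_div_of_isBigO {ε : ℕ → ℝ} (hε : ε =O[atTop] fun k : ℕ => 1 / (k : ℝ)) :
    ∃ B, ∀ k, ε k ≤ B / (k + 1) := by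
  obtain ⟨A, hA0, hA⟩ := hε.exists_pos
  obtain ⟨k₀, hk₀⟩ := eventually_atTop.1 (hA.bound)
  refine ⟨2 * A + ∑ j ∈ Finset.range (k₀ + 1), |ε j| * (j + 1), fun k => ?_⟩
  rw [le_div_iff₀ (by positivity)]
  rcases lt_or_ge k (k₀ + 1) with hk | hk
  · have h1 := Finset.single_le_sum (f := fun j : ℕ => |ε j| * (j + 1 : ℝ))
      (fun j _ => by positivity) (Finset.mem_range.2 hk)
    have h2 : ε k * (k + 1) ≤ |ε k| * (k + 1) := by gcongr; exact le_abs_self _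
    linarith
  · have h1 := hk₀ k (by omega)
    have hk1 : (1 : ℝ) ≤ k := by exact_mod_cast (by omega : 1 ≤ k)
    rw [Real.norm_eq_abs, Real.norm_of_nonneg (by positivity), mul_one_div,
      le_div_iff₀ (by linarith)] at h1
    have h2 : (0 : ℝ) ≤ ∑ j ∈ Finset.range (k₀ + 1), |ε j| * (j + 1) := by positivity
    have h3 : ε k * (k + 1) ≤ |ε k| * (2 * k) :=
      mul_le_mul (le_abs_self _) (by linarith) (by positivity) (abs_nonneg _)
    linarith

end Recursions

/-! ### From pathwise decrease to a recursion for the expected gap. -/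

section Expectation

variable {n m d : ℕ} {f : E n → ℝ} {L β c M₁ M₂ : ℝ}
  {Ω : Type*} [MeasurableSpace Ω] {μ : Measure Ω} [IsProbabilityMeasure μ]
  {S₀ : State n m} {Q : ℕ → Ω → Fin n → Fin d → ℝ}

/-- The matrices `Q` with `‖Q‖² ≤ N` and `‖Qᵀg‖² ≥ t‖g‖²`. -/
def goodMatrices (d : ℕ) (N t : ℝ) (g : E n) : Set (Fin n → Fin d → ℝ) :=
  {Q | t * ‖g‖ ^ 2 ≤ ‖(Matrix.of Q)ᵀ.toEuclideanLin g‖ ^ 2 ∧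
    ∀ v, ‖(Matrix.of Q).toEuclideanLin v‖ ^ 2 ≤ N * ‖v‖ ^ 2}

lemma measurableSet_normBound (n d : ℕ) (N : ℝ) :
    MeasurableSet {Q : Fin n → Fin d → ℝ |
      ∀ v, ‖(Matrix.of Q).toEuclideanLin v‖ ^ 2 ≤ N * ‖v‖ ^ 2} := by
  have : {Q : Fin n → Fin d → ℝ | ∀ v, ‖(Matrix.of Q).toEuclideanLin v‖ ^ 2 ≤ N * ‖v‖ ^ 2}
      = ⋂ v, {Q | ‖(Matrix.of Q).toEuclideanLin v‖ ^ 2 ≤ N * ‖v‖ ^ 2} := by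
    ext; simp
  rw [this]
  refine (isClosed_iInter fun v => isClosed_le ?_ continuous_const).measurableSet
  simp_rw [norm_sq_toEuclideanLin_of, PiLp.inner_apply]
  fun_prop

lemma measurableSet_goodMatrices_prod {F : E n → E n} (hF : Measurable F) (N t : ℝ) :
    MeasurableSet {p : E n × (Fin n → Fin d → ℝ) | p.2 ∈ goodMatrices d N t (F p.1)} := by
  have h1 : Measurable fun p : E n × (Fin n → Fin d → ℝ) =>
      ‖(Matrix.of p.2)ᵀ.toEuclideanLin (F p.1)‖ ^ 2 :=
    (measurable_norm_sq_toEuclideanLin_of d n).comp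
      (f := fun p : E n × (Fin n → Fin d → ℝ) => ((fun j i => p.2 i j : Fin d → Fin n → ℝ), F p.1))
      (by fun_prop)
  exact (measurableSet_le (by fun_prop) h1).inter (measurable_snd (measurableSet_normBound n d N))

lemma f_run_le (hm : 2 ≤ m) (hβ : 0 < β) (hc : 0 < c) (hM₁ : 0 < M₁) (hS₀ : Admissible M₁ M₂ S₀)
    (ε : ℕ → ℝ) (Q : ℕ → Matrix (Fin n) (Fin d) ℝ) (k : ℕ) :
    f (run f β c M₁ M₂ ε Q S₀ k).x ≤ f S₀.x := by
  induction k with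
  | zero => exact le_rfl
  | succ k ih => exact (step_le hβ hc hM₁ (hS₀.run hm ε Q k)).trans ih

lemma integrable_gap (hf : Continuous f) (hm : 2 ≤ m) (hβ : 0 < β) (hc : 0 < c) (hM₁ : 0 < M₁)
    (hS₀ : Admissible M₁ M₂ S₀) (hR : levelRadius f S₀.x ≠ ⊤) (hQm : ∀ k, Measurable (Q k))
    (ε : ℕ → ℝ) (k : ℕ) :
    Integrable (fun ω => f (run f β c M₁ M₂ ε (fun j => Matrix.of (Q j ω)) S₀ k).x - optVal f) μ := by
  refine Integrable.of_mem_Icc 0 (f S₀.x - optVal f) ?_ (Eventually.of_forall fun ω => ⟨?_, ?_⟩)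
  · exact ((hf.measurable.comp (measurable_run hf hm hS₀ ε hQm k)).sub_const _).aemeasurable
  · exact sub_nonneg.2 (optVal_le hR _)
  · exact sub_le_sub_right (f_run_le hm hβ hc hM₁ hS₀ ε _ k) _

/-- One step of the recursion for the expected optimality gap. -/
lemma integral_gap_succ_le (hf : Continuous f) (hm : 2 ≤ m) (hβ : 0 < β) (hc : 0 < c)
    (hM₁ : 0 < M₁) (hS₀ : Admissible M₁ M₂ S₀) (hR : levelRadius f S₀.x ≠ ⊤)
    (hQm : ∀ k, Measurable (Q k)) (hQlaw : ∀ k, μ.map (Q k) = gaussianMatrix n d)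
    (hQind : iIndepFun Q μ) (ε : ℕ → ℝ) (k : ℕ) {F : E n → E n} (hF : Measurable F)
    {N t a p τ : ℝ} (ha : 0 ≤ a)
    (hp : ∀ g : E n, p ≤ (gaussianMatrix n d).real (goodMatrices d N t g))
    (hstep : ∀ (S : State n m) (q : Fin n → Fin d → ℝ), Admissible M₁ M₂ S → f S.x ≤ f S₀.x →
      q ∈ goodMatrices d N t (F S.x) → f (step f β c M₁ M₂ (ε k) (Matrix.of q) S).x
        ≤ f S.x - a * (max (f S.x - optVal f - τ) 0) ^ 2) :
    (∫ ω, (f (run f β c M₁ M₂ ε (fun j => Matrix.of (Q j ω)) S₀ (k + 1)).x - optVal f) ∂μ)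
      ≤ (∫ ω, (f (run f β c M₁ M₂ ε (fun j => Matrix.of (Q j ω)) S₀ k).x - optVal f) ∂μ)
        - a * p * (max ((∫ ω, (f (run f β c M₁ M₂ ε (fun j => Matrix.of (Q j ω)) S₀ k).x
            - optVal f) ∂μ) - τ) 0) ^ 2 := by
  set X : Ω → E n := fun ω => (run f β c M₁ M₂ ε (fun j => Matrix.of (Q j ω)) S₀ k).x with hX
  have hXm : Measurable X := measurable_run hf hm hS₀ ε hQm k
  have hΔ := integrable_gap (μ := μ) hf hm hβ hc hM₁ hS₀ hR hQm ε k
  have hΔ' := integrable_gap (μ := μ) hf hm hβ hc hM₁ hS₀ hR hQm ε (k + 1)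
  set D := ∫ ω, (f (X ω) - optVal f) ∂μ with hD
  set φ : E n → ℝ := fun x => (max (f x - optVal f - τ) 0) ^ 2 with hφ
  have hφm : Measurable φ := by
    have := hf.measurable
    fun_prop
  have hφ0 : ∀ x, 0 ≤ φ x := fun x => by positivity
  have hφint : Integrable (fun ω => φ (X ω)) μ := by
    refine Integrable.of_mem_Icc 0 ((max (f S₀.x - optVal f - τ) 0) ^ 2)
      (hφm.comp hXm).aemeasurable (Eventually.of_forall fun ω => ⟨hφ0 _, ?_⟩)
    have := f_run_le hm hβ hc hM₁ hS₀ ε (fun j => Matrix.of (Q j ω)) k (f := f)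
    simp only [hφ, hX]
    gcongr
  set G : Set (E n × (Fin n → Fin d → ℝ)) := {p | p.2 ∈ goodMatrices d N t (F p.1)} with hG
  have hGm : MeasurableSet G := measurableSet_goodMatrices_prod hF N t
  have hXQ := indepFun_run (M₁ := M₁) (M₂ := M₂) (β := β) (c := c) hf hm hS₀ ε hQm hQind k
  have hprod : μ.map (fun ω => (X ω, Q k ω)) = (μ.map X).prod (gaussianMatrix n d) := by
    rw [← hQlaw k]
    exact (indepFun_iff_map_prod_eq_prod_map_map hXm.aemeasurable (hQm k).aemeasurable).1 hXQ
  have : IsProbabilityMeasure (μ.map X) := Measure.isProbabilityMeasure_map hXm.aemeasurable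
  have hφν : Integrable φ (μ.map X) :=
    (integrable_map_measure hφm.aestronglyMeasurable hXm.aemeasurable).2 hφint
  have hψm : Measurable (G.indicator fun p => φ p.1) := (hφm.comp measurable_fst).indicator hGm
  have hψint : Integrable (G.indicator fun p => φ p.1) ((μ.map X).prod (gaussianMatrix n d)) :=
    (hφν.comp_fst _).indicator hGm
  have hψμ : Integrable (fun ω => G.indicator (fun p => φ p.1) (X ω, Q k ω)) μ := by
    rw [← hprod] at hψint
    exact (integrable_map_measure hψm.aestronglyMeasurable
      (hXm.prodMk (hQm k)).aemeasurable).1 hψint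
  -- the decrease is at least `p` times the expectation of `φ`
  have hexp : p * ∫ ω, φ (X ω) ∂μ ≤ ∫ ω, G.indicator (fun p => φ p.1) (X ω, Q k ω) ∂μ := by
    rw [← integral_map (f := G.indicator fun p => φ p.1) (hXm.prodMk (hQm k)).aemeasurable
      hψm.aestronglyMeasurable, hprod, integral_prod _ hψint,
      ← integral_map (f := φ) hXm.aemeasurable hφm.aestronglyMeasurable, ← integral_const_mul]
    refine integral_mono (hφν.const_mul p) hψint.integral_prod_left fun x => ?_
    have h1 : (fun q => G.indicator (fun p => φ p.1) (x, q))
        = (goodMatrices d N t (F x)).indicator fun _ => φ x := by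
      ext q; simp only [Set.indicator]; rfl
    have h2 : MeasurableSet (goodMatrices d N t (F x)) := measurable_prodMk_left hGm
    simp only [h1]
    rw [integral_indicator_const _ h2, smul_eq_mul]
    exact mul_le_mul_of_nonneg_right (hp _) (hφ0 x)
  -- Jensen's inequality
  have hjensen : (max (D - τ) 0) ^ 2 ≤ ∫ ω, φ (X ω) ∂μ := by
    set u := max (D - τ) 0 with hu
    have hu0 : 0 ≤ u := le_max_right _ _
    -- Jensen for the squared positive part via its tangent at u: t₊² ≥ 2ut - u² for u ≥ 0.
    have h1 : ∫ ω, (2 * u * (f (X ω) - optVal f) - (2 * u * τ + u ^ 2)) ∂μ ≤ ∫ ω, φ (X ω) ∂μ := by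
      refine integral_mono ((hΔ.const_mul _).sub (integrable_const _)) hφint fun ω => ?_
      have e1 := le_max_left (f (X ω) - optVal f - τ) 0
      simp only [hφ]
      nlinarith [sq_nonneg (max (f (X ω) - optVal f - τ) 0 - u), mul_le_mul_of_nonneg_left e1 hu0]
    rw [integral_sub (hΔ.const_mul _) (integrable_const _), integral_const_mul, integral_const,
      probReal_univ, one_smul] at h1
    have h2 : u * (D - τ) = u ^ 2 := by
      rcases le_total (D - τ) 0 with h | h
      · rw [hu, max_eq_right h]; ring
      · rw [hu, max_eq_left h]; ring
    linarith
  have hp1 : ∫ ω, (f (run f β c M₁ M₂ ε (fun j => Matrix.of (Q j ω)) S₀ (k + 1)).x - optVal f) ∂μ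
      ≤ ∫ ω, ((f (X ω) - optVal f) - a * G.indicator (fun p => φ p.1) (X ω, Q k ω)) ∂μ := by
    refine integral_mono hΔ' (hΔ.sub (hψμ.const_mul a)) fun ω => ?_
    have hadm := hS₀.run (f := f) (β := β) (c := c) hm ε (fun j => Matrix.of (Q j ω)) k
    by_cases hmem : (X ω, Q k ω) ∈ G
    · have h1 := hstep _ (Q k ω) hadm (f_run_le hm hβ hc hM₁ hS₀ ε _ k) hmem
      simp only [Set.indicator_of_mem hmem, run]
      simp only [hφ, hX]
      linarith
    · have h1 := step_le (f := f) (β := β) (c := c) (ε := ε k) (Q := Matrix.of (Q k ω)) hβ hc hM₁ hadm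
      simp only [Set.indicator_of_notMem hmem, run]
      simp only [hX]
      linarith
  rw [integral_sub hΔ (hψμ.const_mul a), integral_const_mul] at hp1
  -- For p ≤ 0 the subtracted term is nonpositive, and monotonicity is enough.
  rcases le_or_gt p 0 with hpneg | hppos
  · have h1 : 0 ≤ ∫ ω, G.indicator (fun p => φ p.1) (X ω, Q k ω) ∂μ :=
      integral_nonneg fun ω => Set.indicator_nonneg (fun p _ => hφ0 _) _
    have h2 : a * p * max (D - τ) 0 ^ 2 ≤ 0 :=
      mul_nonpos_of_nonpos_of_nonneg (mul_nonpos_of_nonneg_of_nonpos ha hpneg) (by positivity)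
    have h3 := mul_nonneg ha h1
    linarith
  · have h1 : a * p * max (D - τ) 0 ^ 2 ≤ a * (p * ∫ ω, φ (X ω) ∂μ) := by
      rw [mul_assoc]; gcongr
    have h2 := mul_le_mul_of_nonneg_left hexp ha
    linarith

end Expectation

/-! ### Choice of the good event and comparison with the constant `K`. -/

section Rates

variable {n m d : ℕ} {f : E n → ℝ} {L β c M₁ M₂ : ℝ}
  {Ω : Type*} [MeasurableSpace Ω] {μ : Measure Ω} [IsProbabilityMeasure μ]
  {S₀ : State n m} {Q : ℕ → Ω → Fin n → Fin d → ℝ}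

lemma alphaBar_pos (hL : 0 < L) (hβ : 0 < β) (hc1 : c < 1 / 2) (hM₂ : 0 < M₂) (hm : 2 ≤ m) :
    0 < alphaBar β c M₂ L m := by
  have : 0 < 1 - 2 * c := by linarith
  have : (0 : ℝ) < m := by exact_mod_cast (by omega : 0 < m)
  rw [alphaBar]; positivity

/-- A gap above 2R₀Kε forces ‖g‖ > 2Kε by convexity, so the quadratic decrease applies; below that
level the positive part is 0 and monotonicity suffices. -/
lemma step_decrease_gap (hf : Differentiable ℝ f) (hconv : ConvexOn ℝ Set.univ f) (hL : 0 < L)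
    (hLip : ∀ u v, ‖gradient f u - gradient f v‖ ≤ L * ‖u - v‖) (hβ : 0 < β) (hβ1 : β < 1)
    (hc : 0 < c) (hc1 : c < 1 / 2) (hM₁ : 0 < M₁) (hM₂ : 0 < M₂) (hm : 2 ≤ m)
    {x₀ : E n} (hR : levelRadius f x₀ ≠ ⊤) (hR0 : 0 < (levelRadius f x₀).toReal)
    {ε N s K : ℝ} (hε : 0 < ε) (hN : 0 < N) (hs : 0 < s)
    (hK₁ : 4 * L * √(d * N) ≤ s * K) (hK₂ : 4 * L ≤ s * K)
    (hK₃ : m * (L / 4) ^ 2 * M₂ ≤ c ^ 2 * (M₁ * (29 / 16 * (s * K)) ^ 2))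
    (S : State n m) (q : Fin n → Fin d → ℝ) (hS : Admissible M₁ M₂ S) (hSx : f S.x ≤ f x₀)
    (hq : q ∈ goodMatrices d N (s ^ 2 * N) (gradient f S.x)) :
    f (step f β c M₁ M₂ ε (Matrix.of q) S).x
      ≤ f S.x - (c * alphaBar β c M₂ L m * M₁ * s ^ 2 / (levelRadius f x₀).toReal ^ 2)
        * (max (f S.x - optVal f - 2 * (levelRadius f x₀).toReal * K * ε) 0) ^ 2 := by
  set R := (levelRadius f x₀).toReal
  set g := gradient f S.x
  have hgap : f S.x - optVal f ≤ R * ‖g‖ := sub_optVal_le_gradient hf hconv hR hSx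
  have hα := alphaBar_pos hL hβ hc1 hM₂ hm
  rcases le_or_gt (f S.x - optVal f - 2 * R * K * ε) 0 with h | h
  · rw [max_eq_right h]
    have := step_le (f := f) (β := β) (c := c) (ε := ε) (Q := Matrix.of q) hβ hc hM₁ hS
    linarith
  · rw [max_eq_left h.le]
    have h1 : f S.x - optVal f - 2 * R * K * ε ≤ R * (‖g‖ - 2 * K * ε) := by linarith
    have h2 : 0 < ‖g‖ - 2 * K * ε := pos_of_mul_pos_right (h.trans_le h1) hR0.le
    refine (step_decrease hf hconv hL hLip hβ hβ1 hc hc1 hM₁ hM₂ hm hS hε hN hs hq.2 hq.1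
      hK₁ hK₂ hK₃ (by linarith)).trans ?_
    have h3 : (f S.x - optVal f - 2 * R * K * ε) ^ 2 ≤ (R * (‖g‖ - 2 * K * ε)) ^ 2 := by gcongr
    have h4 : (c * alphaBar β c M₂ L m * M₁ * s ^ 2 / R ^ 2)
        * (f S.x - optVal f - 2 * R * K * ε) ^ 2
        ≤ (c * alphaBar β c M₂ L m * M₁ * s ^ 2 / R ^ 2) * (R * (‖g‖ - 2 * K * ε)) ^ 2 := by
      gcongr
    have h5 : (c * alphaBar β c M₂ L m * M₁ * s ^ 2 / R ^ 2) * (R * (‖g‖ - 2 * K * ε)) ^ 2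
        = c * alphaBar β c M₂ L m * M₁ * s ^ 2 * (‖g‖ - 2 * K * ε) ^ 2 := by
      field_simp
    linarith

lemma levelRadius_zero_dim (f : E 0 → ℝ) (x₀ : E 0) : levelRadius f x₀ = 0 := by
  have h : solutions f = Set.univ := by
    ext x; simp only [solutions, Set.mem_ofPred_eq, Set.mem_univ, iff_true]
    intro y; rw [Subsingleton.elim x y]
  simp [levelRadius, h, Metric.infEDist_zero_of_mem]

/-- For g = 0 the lower bound on ‖Qᵀg‖ is void, so the event contains the one for any other vector.
-/
lemma goodMatrices_of_ne_zero [NeZero n] {N t p : ℝ}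
    (hp : ∀ g : E n, g ≠ 0 → p ≤ (gaussianMatrix n d).real (goodMatrices d N t g)) (g : E n) :
    p ≤ (gaussianMatrix n d).real (goodMatrices d N t g) := by
  rcases eq_or_ne g 0 with rfl | hg
  · refine (hp (EuclideanSpace.single 0 1) ?_).trans (measureReal_mono ?_)
    · rw [← norm_ne_zero_iff]; simp
    · exact fun Q hQ => ⟨by simp, hQ.2⟩
  · exact hp g hg

lemma measure_goodMatrices_ge {N t p q : ℝ} {g : E n}
    (hp : p ≤ (gaussianMatrix n d).real
      {Q | ∀ v, ‖(Matrix.of Q).toEuclideanLin v‖ ^ 2 ≤ N * ‖v‖ ^ 2})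
    (hq : (gaussianMatrix n d).real
      {Q | t * ‖g‖ ^ 2 ≤ ‖(Matrix.of Q)ᵀ.toEuclideanLin g‖ ^ 2}ᶜ ≤ q) :
    p - q ≤ (gaussianMatrix n d).real (goodMatrices d N t g) := by
  have h := measureReal_mono (μ := gaussianMatrix n d)
    (s₁ := {Q | ∀ v, ‖(Matrix.of Q).toEuclideanLin v‖ ^ 2 ≤ N * ‖v‖ ^ 2})
    (s₂ := goodMatrices d N t g ∪ {Q | t * ‖g‖ ^ 2 ≤ ‖(Matrix.of Q)ᵀ.toEuclideanLin g‖ ^ 2}ᶜ) ?_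
  · have := measureReal_union_le (μ := gaussianMatrix n d) (goodMatrices d N t g)
      {Q | t * ‖g‖ ^ 2 ≤ ‖(Matrix.of Q)ᵀ.toEuclideanLin g‖ ^ 2}ᶜ
    linarith
  · intro Q hQ
    by_cases h : t * ‖g‖ ^ 2 ≤ ‖(Matrix.of Q)ᵀ.toEuclideanLin g‖ ^ 2
    · exact Or.inl ⟨h, hQ⟩
    · exact Or.inr h

lemma compl_fiftieth_le (hd : 1 ≤ d) {g : E n} (hg : g ≠ 0) :
    (gaussianMatrix n d).real
      {Q | (1 / 50 * d) * ‖g‖ ^ 2 ≤ ‖(Matrix.of Q)ᵀ.toEuclideanLin g‖ ^ 2}ᶜ ≤ 0.2332 := by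
  refine (measureReal_mono fun Q hQ => ?_).trans (gaussianMatrix_fiftieth_tail hd hg)
  simp only [Set.mem_compl_iff, Set.mem_ofPred_eq, not_le] at hQ ⊢
  linarith

lemma IsOpNormConst.measure_ge {C : ℝ} (hd : 1 ≤ d) (hC : IsOpNormConst n d C) :
    1 - 2 * Real.exp (-(d : ℝ)) ≤ (gaussianMatrix n d).real
      {Q | ∀ v, ‖(Matrix.of Q).toEuclideanLin v‖ ^ 2 ≤ C * n * ‖v‖ ^ 2} := by
  refine hC.2.trans (measureReal_mono fun Q hQ => ?_)
  have hd0 : (0 : ℝ) < d := by exact_mod_cast hd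
  have hC0 := hC.1
  simp only [Set.mem_ofPred_eq] at hQ
  rw [one_div, inv_mul_le_iff₀ hd0] at hQ
  have h2 : (d : ℝ) * (C * (n / d)) = C * n := by field_simp
  rw [h2] at hQ
  exact norm_toEuclideanLin_sq_le_opNorm _ (by positivity) hQ

lemma IsVectorNormConst.compl_le {C₀ δ : ℝ} (hd : 1 ≤ d) (hC₀ : IsVectorNormConst n d C₀)
    (hδ : 0 < δ) (hδ1 : δ < 1) (g : E n) :
    (gaussianMatrix n d).real
      {Q | ((1 - δ) * d) * ‖g‖ ^ 2 ≤ ‖(Matrix.of Q)ᵀ.toEuclideanLin g‖ ^ 2}ᶜ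
      ≤ 2 * Real.exp (-C₀ * δ ^ 2 * d) := by
  have hd0 : (0 : ℝ) < d := by exact_mod_cast hd
  have h := hC₀.2 δ hδ hδ1 g
  have hms : MeasurableSet {Q : Fin n → Fin d → ℝ |
      ((1 - δ) * d) * ‖g‖ ^ 2 ≤ ‖(Matrix.of Q)ᵀ.toEuclideanLin g‖ ^ 2} := by
    have : Measurable fun Q : Fin n → Fin d → ℝ => ‖(Matrix.of Q)ᵀ.toEuclideanLin g‖ ^ 2 :=
      (measurable_norm_sq_toEuclideanLin_of d n).comp
        (f := fun Q : Fin n → Fin d → ℝ => ((fun j i => Q i j : Fin d → Fin n → ℝ), g)) (by fun_prop)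
    exact measurableSet_le measurable_const this
  rw [probReal_compl_eq_one_sub hms, sub_le_comm]
  refine h.trans (measureReal_mono fun Q hQ => ?_)
  have h1 := hQ.1
  rw [norm_sq_inv_sqrt_smul, le_div_iff₀ hd0] at h1
  simp only [Set.mem_ofPred_eq]
  linarith

/-- Existence of a lower bound `η d` for `‖Qᵀg‖²/‖g‖²` which is at least as good for the rate as
`(1-δ) d`, and for which the finite differences dominate their error. -/
lemma exists_good_level {C₀ C δ : ℝ} (hd : 1 ≤ d) [NeZero n] (hC₀ : IsVectorNormConst n d C₀)
    (hC : IsOpNormConst n d C) (hδ : 0 < δ) (hδ1 : δ < 1) (hp : 0 < probBound C₀ δ d) :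
    ∃ η p : ℝ, 1 - δ ≤ η ∧ η * d ≤ C * n ∧ d ≤ 15138 * (η * (C * n)) ∧ 0 ≤ p ∧
      probBound C₀ δ d * (1 - δ) ^ 2 * d ^ 2 / (C * n) ^ 2 ≤ η * d / (C * n) * p ∧
      ∀ g : E n, p ≤ (gaussianMatrix n d).real (goodMatrices d (C * n) (η * d) g) := by
  have hd0 : (0 : ℝ) < d := by exact_mod_cast hd
  have hn0 : (0 : ℝ) < n := by exact_mod_cast Nat.pos_of_ne_zero (NeZero.ne n)
  have hCn : 0 < C * n := mul_pos hC.1 hn0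
  set N := C * n with hN
  have hB := hC.measure_ge hd
  set r := 1 - 2 * Real.exp (-(d : ℝ)) with hr
  have hpr : probBound C₀ δ d = r - 2 * Real.exp (-C₀ * δ ^ 2 * d) := by
    rw [probBound, hr]; ring
  have hpr' : probBound C₀ δ d ≤ r := by
    rw [hpr]; have := Real.exp_pos (-C₀ * δ ^ 2 * d); linarith
  have hδ0 : 0 < 1 - δ := by linarith
  set g₀ : E n := EuclideanSpace.single 0 1
  have hg₀ : g₀ ≠ 0 := by rw [← norm_ne_zero_iff]; simp [g₀]
  -- `constK_bounds` needs d ≤ 15138 η N. Either η = 1-δ meets this, or 1-δ < d/(15138 N) and η =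
  -- 1/50 takes its place.
  rcases le_or_gt (d : ℝ) (15138 * ((1 - δ) * N)) with hreg | hbad
  · have hgood : ∀ g : E n, probBound C₀ δ d
        ≤ (gaussianMatrix n d).real (goodMatrices d N ((1 - δ) * d) g) := by
      intro g
      rw [hpr]
      exact measure_goodMatrices_ge hB (hC₀.compl_le hd hδ hδ1 g)
    -- An event of positive probability contains some matrix, and for it (1-δ)d‖g₀‖² ≤ ‖Qᵀg₀‖² ≤
    -- N‖g₀‖².
    have hle : (1 - δ) * d ≤ N := by
      have hne : (goodMatrices d N ((1 - δ) * d) g₀).Nonempty := by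
        by_contra hcon
        have h := hgood g₀
        rw [Set.not_nonempty_iff_eq_empty.1 hcon, measureReal_empty] at h
        linarith
      obtain ⟨q, hq1, hq2⟩ := hne
      have h1 := norm_transpose_toEuclideanLin_sq_le (Matrix.of q)ᵀ hCn.le (by simpa using hq2) g₀
      have h2 : 0 < ‖g₀‖ ^ 2 := by have := norm_pos_iff.2 hg₀; positivity
      exact le_of_mul_le_mul_right (hq1.trans h1) h2
    refine ⟨1 - δ, probBound C₀ δ d, le_rfl, hle, hreg, hp.le, ?_, hgood⟩
    have h1 : (1 - δ) * d / N ≤ 1 := (div_le_one hCn).2 hle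
    have h2 : 0 ≤ (1 - δ) * d / N * probBound C₀ δ d := by positivity
    calc _ = (1 - δ) * d / N * ((1 - δ) * d / N * probBound C₀ δ d) := by
          field_simp
      _ ≤ 1 * ((1 - δ) * d / N * probBound C₀ δ d) := by gcongr
      _ = _ := one_mul _
  · have hr0 : 0.264 ≤ r := by
      have h1 : Real.exp (-(d : ℝ)) ≤ Real.exp (-1) := by
        have : (1 : ℝ) ≤ d := by exact_mod_cast hd
        gcongr
      have h2 : Real.exp (-1) ≤ 0.3679 := by
        rw [Real.exp_neg, inv_le_comm₀ (Real.exp_pos _) (by norm_num)]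
        have := Real.exp_one_gt_d9
        norm_num1 at this ⊢
        linarith
      rw [hr]
      norm_num1 at h2 ⊢
      linarith
    have hr1 : r ≤ 1 := by have := Real.exp_pos (-(d : ℝ)); linarith
    have hgood : ∀ g : E n, r - 0.2332
        ≤ (gaussianMatrix n d).real (goodMatrices d N (1 / 50 * d) g) :=
      goodMatrices_of_ne_zero fun g hg => measure_goodMatrices_ge hB (compl_fiftieth_le hd hg)
    have hle : 1 / 50 * d ≤ N := by
      have hne : (goodMatrices d N (1 / 50 * d) g₀).Nonempty := by
        by_contra hcon
        have h := hgood g₀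
        rw [Set.not_nonempty_iff_eq_empty.1 hcon, measureReal_empty] at h
        norm_num1 at h hr0
        linarith
      obtain ⟨q, hq1, hq2⟩ := hne
      have h1 := norm_transpose_toEuclideanLin_sq_le (Matrix.of q)ᵀ hCn.le (by simpa using hq2) g₀
      have h2 : 0 < ‖g₀‖ ^ 2 := by have := norm_pos_iff.2 hg₀; positivity
      exact le_of_mul_le_mul_right (hq1.trans h1) h2
    have hdN : (d : ℝ) / N ≤ 50 := by rw [div_le_iff₀ hCn]; linarith
    have hδN : (1 - δ) ≤ d / N / 15138 := by
      rw [div_div, le_div_iff₀ (by positivity)]; linarith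
    have hδs : 1 - δ ≤ 50 / 15138 := hδN.trans (by gcongr)
    refine ⟨1 / 50, r - 0.2332, by linarith, hle, by linarith, ?_, ?_, hgood⟩
    · norm_num1 at hr0 ⊢
      linarith
    -- The margin is thin: 50(50/15138)² < 0.00055, while (0.264-0.2332)/50 > 0.00061.
    · have h1 : (1 - δ) ^ 2 ≤ (50 / 15138) ^ 2 := by gcongr
      have h2 : probBound C₀ δ d * (1 - δ) ^ 2 * (d / N) ≤ r * (50 / 15138) ^ 2 * 50 := by
        have : 0 ≤ r := hp.le.trans hpr'
        gcongr
      have h3 : r * (50 / 15138) ^ 2 * 50 ≤ 1 / 50 * (r - 0.2332) := by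
        norm_num1 at hr0 ⊢
        linarith
      calc _ = (d / N) * (probBound C₀ δ d * (1 - δ) ^ 2 * (d / N)) := by field_simp
        _ ≤ (d / N) * (1 / 50 * (r - 0.2332)) :=
            mul_le_mul_of_nonneg_left (h2.trans h3) (by positivity)
        _ = _ := by ring

/-- The constant `K` dominates the errors of the finite differences. -/
lemma constK_bounds {C δ η : ℝ} (hL : 0 < L) (hc : 0 < c) (hM₁ : 0 < M₁) (hM : M₁ ≤ M₂)
    (hm : 2 ≤ m) (hd : 1 ≤ d) (hδ : 0 < δ) (hδ1 : δ < 1) (hCn : 0 < C * n) (hη : 1 - δ ≤ η)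
    (hηd : η * d ≤ C * n) (hη' : d ≤ 15138 * (η * (C * n))) :
    4 * L * √(d * (C * n)) ≤ √(η * d / (C * n)) * constK C δ c M₁ M₂ L n m d ∧
    4 * L ≤ √(η * d / (C * n)) * constK C δ c M₁ M₂ L n m d ∧
    m * (L / 4) ^ 2 * M₂ ≤ c ^ 2 * (M₁ *
      (29 / 16 * (√(η * d / (C * n)) * constK C δ c M₁ M₂ L n m d)) ^ 2) := by
  have hd0 : (0 : ℝ) < d := by exact_mod_cast hd
  have hd1 : (1 : ℝ) ≤ d := by exact_mod_cast hd
  have hm2 : (2 : ℝ) ≤ m := by exact_mod_cast hm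
  have hδ0 : 0 < 1 - δ := by linarith
  have hη0 : 0 < η := hδ0.trans_le hη
  have hM₂ : 0 < M₂ := hM₁.trans_le hM
  set N := C * n with hN
  set s := √(η * d / N) with hs
  have hs2 : s ^ 2 = η * d / N := Real.sq_sqrt (by positivity)
  have hs0 : 0 < s := Real.sqrt_pos.2 (by positivity)
  have hKA : 4 * √d * N / (1 - δ) * L ≤ constK C δ c M₁ M₂ L n m d := by
    rw [constK, hN, ← mul_assoc]
    gcongr
    exact le_max_left _ _
  have hKB : 6 * N * m ^ 2 / d * (M₂ / (M₁ * c)) * L ≤ constK C δ c M₁ M₂ L n m d := by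
    rw [constK, hN, ← mul_assoc]
    gcongr
    refine le_trans ?_ (le_max_right _ _)
    rw [mul_assoc 6 C]
    gcongr
    linarith
  have hA0 : 0 ≤ 4 * √(d : ℝ) * N / (1 - δ) * L := by positivity
  have hA2 : (s * (4 * √d * N / (1 - δ) * L)) ^ 2 = (4 * L) ^ 2 * (d ^ 2 * N * (η / (1 - δ) ^ 2)) := by
    rw [mul_pow, hs2, mul_pow, div_pow, mul_pow, mul_pow, Real.sq_sqrt hd0.le]
    field_simp
  have hη1 : 1 ≤ η / (1 - δ) := (one_le_div hδ0).2 hη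
  have hη2 : 1 ≤ η / (1 - δ) ^ 2 := by
    rw [one_le_div (by positivity)]
    nlinarith
  refine ⟨?_, ?_, ?_⟩
  · refine le_trans ?_ (mul_le_mul_of_nonneg_left hKA hs0.le)
    refine abs_le_of_sq_le_sq' ?_ (by positivity) |>.2
    rw [hA2, mul_pow, Real.sq_sqrt (by positivity)]
    refine mul_le_mul_of_nonneg_left ?_ (by positivity)
    calc (d : ℝ) * N = 1 * d * N * 1 := by ring
      _ ≤ d * d * N * (η / (1 - δ) ^ 2) := by gcongr
      _ = _ := by ring
  · refine le_trans ?_ (mul_le_mul_of_nonneg_left hKA hs0.le)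
    refine abs_le_of_sq_le_sq' ?_ (by positivity) |>.2
    rw [hA2]
    refine le_mul_of_one_le_right (by positivity) ?_
    -- One factor N is traded for its lower bound ηd.
    calc (1 : ℝ) ≤ d ^ 3 * (η / (1 - δ)) ^ 2 :=
          one_le_mul_of_one_le_of_one_le (one_le_pow₀ hd1) (one_le_pow₀ hη1)
      _ = d ^ 2 * (η * d) * (η / (1 - δ) ^ 2) := by field_simp
      _ ≤ _ := by gcongr
  · have h1 : (s * (6 * N * m ^ 2 / d * (M₂ / (M₁ * c)) * L)) ^ 2
        ≤ (s * constK C δ c M₁ M₂ L n m d) ^ 2 := by gcongr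
    have h2 : (s * (6 * N * m ^ 2 / d * (M₂ / (M₁ * c)) * L)) ^ 2
        = 36 * (η * N / d) * m ^ 4 * M₂ ^ 2 * L ^ 2 / (M₁ ^ 2 * c ^ 2) := by
      rw [mul_pow, hs2]
      field_simp
      ring
    -- 15138 = 16·8·36·(29/16)²: 16 from (L/4)², 8 ≤ m³, 36 from the 6 in `constK`, and 29/16 from
    -- the lower bound on ‖h‖.
    have h3 : 1 ≤ 15138 * (η * N / d) := by
      rw [← mul_div_assoc, one_le_div hd0]; exact hη'
    have h4 : (8 : ℝ) ≤ m ^ 3 := by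
      calc (8 : ℝ) = 2 ^ 3 := by norm_num
        _ ≤ _ := by gcongr
    calc m * (L / 4) ^ 2 * M₂ = 1 / 16 * m * L ^ 2 * M₂ * (8 / 8) := by ring
      _ ≤ 1 / 16 * m * L ^ 2 * M₂ * ((15138 * (η * N / d)) * m ^ 3 / 8 * (M₂ / M₁)) := by
          gcongr
          rw [div_self (by norm_num : (8 : ℝ) ≠ 0)]
          have e1 : 1 ≤ m ^ 3 / (8 : ℝ) := by linarith
          have e2 : 1 ≤ M₂ / M₁ := (one_le_div hM₁).2 hM
          calc (1 : ℝ) ≤ (15138 * (η * N / d)) * (m ^ 3 / 8) * (M₂ / M₁) :=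
                one_le_mul_of_one_le_of_one_le (one_le_mul_of_one_le_of_one_le h3 e1) e2
            _ = _ := by ring
      _ = c ^ 2 * (M₁ * ((29 / 16) ^ 2 *
            (36 * (η * N / d) * m ^ 4 * M₂ ^ 2 * L ^ 2 / (M₁ ^ 2 * c ^ 2)))) := by
          field_simp
          ring
      _ = c ^ 2 * (M₁ * ((29 / 16) ^ 2 * (s * (6 * N * m ^ 2 / d * (M₂ / (M₁ * c)) * L)) ^ 2)) := by
          rw [h2]
      _ ≤ c ^ 2 * (M₁ * ((29 / 16) ^ 2 * (s * constK C δ c M₁ M₂ L n m d) ^ 2)) := by gcongr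
      _ = _ := by ring

end Rates

/-! ### The two convergence rates. -/

section Main

variable {n m d : ℕ} {f : E n → ℝ} {L β c M₁ M₂ : ℝ}
  {Ω : Type*} [MeasurableSpace Ω] {μ : Measure Ω}
  {S₀ : State n m} {Q : ℕ → Ω → Fin n → Fin d → ℝ}

/-- The expected optimality gap before iteration `k`. -/
def expGap (μ : Measure Ω) (f : E n → ℝ) (β c M₁ M₂ : ℝ) (ε : ℕ → ℝ)
    (Q : ℕ → Ω → Fin n → Fin d → ℝ) (S₀ : State n m) (k : ℕ) : ℝ :=
  ∫ ω, (f (run f β c M₁ M₂ ε (fun j => Matrix.of (Q j ω)) S₀ k).x - optVal f) ∂μ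

lemma expGap_nonneg (hR : levelRadius f S₀.x ≠ ⊤) (ε : ℕ → ℝ) (k : ℕ) :
    0 ≤ expGap μ f β c M₁ M₂ ε Q S₀ k :=
  integral_nonneg fun _ => sub_nonneg.2 (optVal_le hR _)

variable [IsProbabilityMeasure μ]

lemma expGap_zero (ε : ℕ → ℝ) : expGap μ f β c M₁ M₂ ε Q S₀ 0 = f S₀.x - optVal f := by
  simp [expGap, run]

lemma expGap_succ_le (hf : Continuous f) (hm : 2 ≤ m) (hβ : 0 < β) (hc : 0 < c) (hM₁ : 0 < M₁)
    (hS₀ : Admissible M₁ M₂ S₀) (hR : levelRadius f S₀.x ≠ ⊤) (hQm : ∀ k, Measurable (Q k))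
    (ε : ℕ → ℝ) (k : ℕ) :
    expGap μ f β c M₁ M₂ ε Q S₀ (k + 1) ≤ expGap μ f β c M₁ M₂ ε Q S₀ k :=
  integral_mono (integrable_gap hf hm hβ hc hM₁ hS₀ hR hQm ε (k + 1))
    (integrable_gap hf hm hβ hc hM₁ hS₀ hR hQm ε k) fun _ =>
    sub_le_sub_right (step_le hβ hc hM₁ (hS₀.run hm ε _ k)) _

lemma expGap_le_zero_index (hf : Continuous f) (hm : 2 ≤ m) (hβ : 0 < β) (hc : 0 < c)
    (hM₁ : 0 < M₁) (hS₀ : Admissible M₁ M₂ S₀) (hR : levelRadius f S₀.x ≠ ⊤)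
    (hQm : ∀ k, Measurable (Q k)) (ε : ℕ → ℝ) (k : ℕ) :
    expGap μ f β c M₁ M₂ ε Q S₀ k ≤ f S₀.x - optVal f := by
  rw [← expGap_zero (μ := μ) (f := f) (β := β) (c := c) (M₁ := M₁) (M₂ := M₂) (Q := Q) (S₀ := S₀) ε]
  exact antitone_nat_of_succ_le (expGap_succ_le hf hm hβ hc hM₁ hS₀ hR hQm ε) (Nat.zero_le k)

lemma expGap_recursion (hf : Differentiable ℝ f) (hconv : ConvexOn ℝ Set.univ f) (hL : 0 < L)
    (hLip : ∀ u v, ‖gradient f u - gradient f v‖ ≤ L * ‖u - v‖) (hβ : 0 < β) (hβ1 : β < 1)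
    (hc : 0 < c) (hc1 : c < 1 / 2) (hM₁ : 0 < M₁) (hM₂ : 0 < M₂) (hm : 2 ≤ m)
    (hS₀ : Admissible M₁ M₂ S₀) (hR : levelRadius f S₀.x ≠ ⊤)
    (hR0 : 0 < (levelRadius f S₀.x).toReal) (hQm : ∀ k, Measurable (Q k))
    (hQlaw : ∀ k, μ.map (Q k) = gaussianMatrix n d) (hQind : iIndepFun Q μ) {ε : ℕ → ℝ}
    (hε : ∀ k, 0 < ε k) {N s K p : ℝ} (hN : 0 < N) (hs : 0 < s)
    (hK₁ : 4 * L * √(d * N) ≤ s * K) (hK₂ : 4 * L ≤ s * K)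
    (hK₃ : m * (L / 4) ^ 2 * M₂ ≤ c ^ 2 * (M₁ * (29 / 16 * (s * K)) ^ 2))
    (hp : ∀ g : E n, p ≤ (gaussianMatrix n d).real (goodMatrices d N (s ^ 2 * N) g)) (k : ℕ) :
    expGap μ f β c M₁ M₂ ε Q S₀ (k + 1) ≤ expGap μ f β c M₁ M₂ ε Q S₀ k
      - c * alphaBar β c M₂ L m * M₁ * s ^ 2 / (levelRadius f S₀.x).toReal ^ 2 * p
        * (max (expGap μ f β c M₁ M₂ ε Q S₀ k - 2 * (levelRadius f S₀.x).toReal * K * ε k) 0) ^ 2 := by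
  have hα := alphaBar_pos hL hβ hc1 hM₂ hm
  have hgc : Continuous (gradient f) := by
    have : LipschitzWith ⟨L, hL.le⟩ (gradient f) := LipschitzWith.of_dist_le_mul fun u v => by
      rw [dist_eq_norm, dist_eq_norm]; exact hLip u v
    exact this.continuous
  exact integral_gap_succ_le hf.continuous hm hβ hc hM₁ hS₀ hR hQm hQlaw hQind ε k
    hgc.measurable (by positivity) hp
    (step_decrease_gap hf hconv hL hLip hβ hβ1 hc hc1 hM₁ hM₂ hm hR hR0 (hε k) hN hs hK₁ hK₂ hK₃)

/-- The bound for a fixed precision. -/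
lemma expGap_le (hf : Differentiable ℝ f) (hconv : ConvexOn ℝ Set.univ f) (hL : 0 < L)
    (hLip : ∀ u v, ‖gradient f u - gradient f v‖ ≤ L * ‖u - v‖) (hβ : 0 < β) (hβ1 : β < 1)
    (hc : 0 < c) (hc1 : c < 1 / 2) (hM₁ : 0 < M₁) (hM₂ : 0 < M₂) (hm : 2 ≤ m) (hd : 1 ≤ d)
    (hS₀ : Admissible M₁ M₂ S₀) (hR : levelRadius f S₀.x ≠ ⊤) (hQm : ∀ k, Measurable (Q k))
    (hQlaw : ∀ k, μ.map (Q k) = gaussianMatrix n d) (hQind : iIndepFun Q μ) {C₀ C δ ε : ℝ}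
    (hC₀ : IsVectorNormConst n d C₀) (hC : IsOpNormConst n d C) (hδ : 0 < δ) (hδ1 : δ < 1)
    (hp : 0 ≤ probBound C₀ δ d) (hε : 0 < ε) (k : ℕ) :
    expGap μ f β c M₁ M₂ (fun _ => ε) Q S₀ k ≤
      L * C ^ 2 * n ^ 2 * (levelRadius f S₀.x).toReal ^ 2 /
        (2 * C ^ 2 * n ^ 2 + L * c * M₁ * probBound C₀ δ d * (1 - δ) ^ 2 * d ^ 2 * k
          * alphaBar β c M₂ L m)
        + 2 * (levelRadius f S₀.x).toReal * constK C δ c M₁ M₂ L n m d * ε := by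
  have hgap0 := sub_optVal_le_sq hf hL hLip hR
  have hα := alphaBar_pos hL hβ hc1 hM₂ hm
  have hC0 := hC.1
  have hD0 := expGap_zero (μ := μ) (f := f) (β := β) (c := c) (M₁ := M₁) (M₂ := M₂) (Q := Q)
    (S₀ := S₀) fun _ => ε
  have hmono := expGap_succ_le (μ := μ) hf.continuous hm hβ hc hM₁ hS₀ hR hQm (fun _ => ε)
  have hle0 := expGap_le_zero_index (μ := μ) hf.continuous hm hβ hc hM₁ hS₀ hR hQm (fun _ => ε) k
  set D := expGap μ f β c M₁ M₂ (fun _ => ε) Q S₀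
  -- If R₀ = 0 the starting point is optimal and all gaps vanish. Otherwise n ≠ 0, since R₀ = 0 in
  -- dimension zero.
  rcases (ENNReal.toReal_nonneg (a := levelRadius f S₀.x)).eq_or_lt with hR0 | hR0
  · rw [← hR0] at hgap0 ⊢
    simp only [ne_eq, OfNat.ofNat_ne_zero, not_false_eq_true, zero_pow, mul_zero, zero_mul,
      zero_div, add_zero] at hgap0 ⊢
    linarith
  have hn : n ≠ 0 := by
    rintro rfl
    rw [levelRadius_zero_dim] at hR0
    simp at hR0
  have : NeZero n := ⟨hn⟩
  have : NeZero m := ⟨by omega⟩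
  have hn0 : (0 : ℝ) < n := by exact_mod_cast Nat.pos_of_ne_zero hn
  have hd0 : (0 : ℝ) < d := by exact_mod_cast hd
  have hCn : 0 < C * n := mul_pos hC0 hn0
  have hδ0 : 0 < 1 - δ := by linarith
  set R := (levelRadius f S₀.x).toReal
  set K := constK C δ c M₁ M₂ L n m d
  set π := probBound C₀ δ d * (1 - δ) ^ 2 * d ^ 2 / (C * n) ^ 2 with hπ
  have hK0 : 0 ≤ K := by
    have : 0 ≤ max (4 * √(d : ℝ) * C * n / (1 - δ)) (6 * C * n * m ^ 2 / d * (M₂ / (M₁ * c) + 1)) :=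
      (by positivity : 0 ≤ 4 * √(d : ℝ) * C * n / (1 - δ)).trans (le_max_left _ _)
    exact mul_nonneg this hL.le
  have hrec : ∀ k, D (k + 1) ≤ D k
      - c * alphaBar β c M₂ L m * M₁ * π / R ^ 2 * (max (D k - 2 * R * K * ε) 0) ^ 2 := by
    -- At probability bound 0 the recursion is mere monotonicity; `exists_good_level` needs it
    -- positive.
    rcases hp.eq_or_lt with hp0 | hp0
    · intro k
      rw [hπ, ← hp0]
      simpa using hmono k
    · obtain ⟨η, p, hη, hηd, hη', hp', hle, hgood⟩ := exists_good_level hd hC₀ hC hδ hδ1 hp0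
      obtain ⟨hK₁, hK₂, hK₃⟩ := constK_bounds (L := L) (c := c) (m := m) hL hc hM₁ hS₀.2.le hm hd
        hδ hδ1 hCn hη hηd hη'
      have hη0 : 0 < η := by linarith
      have hs2 : √(η * d / (C * n)) ^ 2 = η * d / (C * n) := Real.sq_sqrt (by positivity)
      intro k
      refine (expGap_recursion hf hconv hL hLip hβ hβ1 hc hc1 hM₁ hM₂ hm hS₀ hR hR0 hQm hQlaw hQind
        (fun _ => hε) hCn (Real.sqrt_pos.2 (by positivity)) hK₁ hK₂ hK₃ (p := p) ?_ k).trans ?_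
      · rw [hs2, div_mul_cancel₀ _ hCn.ne']
        exact hgood
      · rw [hs2]
        refine sub_le_sub_left (mul_le_mul_of_nonneg_right ?_ (by positivity)) _
        calc _ = c * alphaBar β c M₂ L m * M₁ / R ^ 2 * π := by ring
          _ ≤ c * alphaBar β c M₂ L m * M₁ / R ^ 2 * (η * d / (C * n) * p) := by gcongr
          _ = _ := by ring
  have hπ0 : 0 ≤ π := by positivity
  have hfin := le_one_div_of_quadratic_decrease (D := D)
    (b := c * alphaBar β c M₂ L m * M₁ * π / R ^ 2) (S := 2 / (L * R ^ 2)) (τ := 2 * R * K * ε)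
    (by positivity) (by positivity) ?_ hrec k
  · refine hfin.trans (le_of_eq ?_)
    congr 1
    have e1 : 2 / (L * R ^ 2) + c * alphaBar β c M₂ L m * M₁ * π / R ^ 2 * k
        = (2 * C ^ 2 * n ^ 2 + L * c * M₁ * probBound C₀ δ d * (1 - δ) ^ 2 * d ^ 2 * k
          * alphaBar β c M₂ L m) / (L * C ^ 2 * n ^ 2 * R ^ 2) := by
      rw [hπ]
      field_simp
    rw [e1, one_div_div]
  · have e2 : 1 / (2 / (L * R ^ 2)) = L / 2 * R ^ 2 := by field_simp
    rw [e2, hD0]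
    have : 0 ≤ 2 * R * K * ε := by positivity
    linarith

/-- The rate for precisions of order `1/k`. -/
lemma expGap_isBigO (hf : Differentiable ℝ f) (hconv : ConvexOn ℝ Set.univ f) (hL : 0 < L)
    (hLip : ∀ u v, ‖gradient f u - gradient f v‖ ≤ L * ‖u - v‖) (hβ : 0 < β) (hβ1 : β < 1)
    (hc : 0 < c) (hc1 : c < 1 / 2) (hM₁ : 0 < M₁) (hM₂ : 0 < M₂) (hm : 2 ≤ m) (hd : 1 ≤ d)
    (hS₀ : Admissible M₁ M₂ S₀) (hR : levelRadius f S₀.x ≠ ⊤) (hQm : ∀ k, Measurable (Q k))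
    (hQlaw : ∀ k, μ.map (Q k) = gaussianMatrix n d) (hQind : iIndepFun Q μ) {ε : ℕ → ℝ}
    (hε : ∀ k, 0 < ε k) (hεO : ε =O[atTop] fun k : ℕ => 1 / (k : ℝ)) :
    (fun k : ℕ => expGap μ f β c M₁ M₂ ε Q S₀ k) =O[atTop] fun k : ℕ => 1 / (k : ℝ) := by
  suffices h : ∃ M : ℝ, 0 ≤ M ∧ ∀ k : ℕ, expGap μ f β c M₁ M₂ ε Q S₀ k ≤ M / (k + 1) by
    obtain ⟨M, hM0, hM⟩ := h
    refine IsBigO.of_bound M ((eventually_ge_atTop 1).mono fun k hk => ?_)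
    have hk0 : (0 : ℝ) < k := by exact_mod_cast hk
    rw [Real.norm_of_nonneg (expGap_nonneg hR ε k), Real.norm_of_nonneg (by positivity),
      mul_one_div]
    refine (hM k).trans ?_
    gcongr
    linarith
  have hα := alphaBar_pos hL hβ hc1 hM₂ hm
  rcases (ENNReal.toReal_nonneg (a := levelRadius f S₀.x)).eq_or_lt with hR0 | hR0
  · refine ⟨0, le_rfl, fun k => ?_⟩
    have h1 := sub_optVal_le_sq hf hL hLip hR
    have h2 := expGap_le_zero_index (μ := μ) hf.continuous hm hβ hc hM₁ hS₀ hR hQm ε k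
    rw [← hR0] at h1
    simp only [ne_eq, OfNat.ofNat_ne_zero, not_false_eq_true, zero_pow, mul_zero, zero_div] at h1 ⊢
    exact h2.trans h1
  have hn : n ≠ 0 := by
    rintro rfl
    rw [levelRadius_zero_dim] at hR0
    simp at hR0
  have : NeZero n := ⟨hn⟩
  have hn0 : (1 : ℝ) ≤ n := by exact_mod_cast Nat.one_le_iff_ne_zero.2 hn
  have hd0 : (1 : ℝ) ≤ d := by exact_mod_cast hd
  have hm0 : (0 : ℝ) < m := by exact_mod_cast (by omega : 0 < m)
  obtain ⟨B, hB⟩ := exists_le_div_of_isBigO hεO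
  set R := (levelRadius f S₀.x).toReal
  -- The rate needs no particular constants, so the explicit tail bounds are used for all n and d,
  -- and K is simply taken large enough; X is chosen to make the third condition on K hold.
  set N : ℝ := 48 * (n + d) with hN
  have hN0 : 0 < N := by positivity
  set s := √(1 / 50 * d / N) with hs
  have hs0 : 0 < s := Real.sqrt_pos.2 (by positivity)
  have hs2 : s ^ 2 * N = 1 / 50 * d := by
    rw [hs, Real.sq_sqrt (by positivity), div_mul_cancel₀ _ hN0.ne']
  set X := √(m * (L / 4) ^ 2 * M₂ / (c ^ 2 * M₁)) with hX
  have hX2 : c ^ 2 * (M₁ * X ^ 2) = m * (L / 4) ^ 2 * M₂ := by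
    rw [hX, Real.sq_sqrt (by positivity)]; field_simp
  set K := (4 * L * √(d * N) + 4 * L + X) / s with hK
  have hsK : s * K = 4 * L * √(d * N) + 4 * L + X := mul_div_cancel₀ _ hs0.ne'
  -- Since n + d ≥ 2, the probability is at least 1 - 2e⁻² - 0.2332 > 0.4.
  have hp : ∀ g : E n, (0.4 : ℝ) ≤ (gaussianMatrix n d).real (goodMatrices d N (s ^ 2 * N) g) := by
    rw [hs2]
    refine goodMatrices_of_ne_zero fun g hg => ?_
    have h1 := one_sub_le_of_compl (gaussianMatrix_norm_tail_le n d)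
    refine le_trans ?_ (measure_goodMatrices_ge h1 (compl_fiftieth_le hd hg))
    have h2 : Real.exp (-(n + d : ℝ)) ≤ Real.exp (-1) * Real.exp (-1) := by
      rw [← Real.exp_add]
      refine Real.exp_le_exp.2 ?_
      linarith
    have h3 : Real.exp (-1) ≤ 0.3679 := by
      rw [Real.exp_neg, inv_le_comm₀ (Real.exp_pos _) (by norm_num)]
      have := Real.exp_one_gt_d9
      norm_num1 at this ⊢
      linarith
    have h4 : Real.exp (-1) * Real.exp (-1) ≤ 0.3679 * 0.3679 := by gcongr
    norm_num1 at h4 ⊢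
    linarith
  have hX0 : 0 ≤ X := Real.sqrt_nonneg _
  have hrec := fun k => expGap_recursion (μ := μ) hf hconv hL hLip hβ hβ1 hc hc1 hM₁ hM₂ hm hS₀ hR
    hR0 hQm hQlaw hQind hε hN0 hs0 (K := K) (by rw [hsK]; linarith)
    (by rw [hsK]; have : 0 ≤ 4 * L * √(d * N) := by positivity
        linarith)
    (by
      rw [hsK, ← hX2]
      gcongr
      have : 0 ≤ 4 * L * √(d * N) := by positivity
      linarith) hp k
  have hK0 : 0 ≤ K := by positivity
  set b := c * alphaBar β c M₂ L m * M₁ * s ^ 2 / R ^ 2 * 0.4 with hb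
  have hb0 : 0 < b := by positivity
  have hfin := le_div_of_quadratic_decrease hb0 (B := 2 * R * K * B)
    (τ := fun k => 2 * R * K * ε k)
    (fun k => by rw [mul_div_assoc]; exact mul_le_mul_of_nonneg_left (hB k) (by positivity)) hrec
  exact ⟨_, le_trans (by positivity) ((le_max_right _ _).trans (le_max_left _ _)), hfin⟩

end Main

end SubspaceQN

end

open SubspaceQN in
theorem theorem6
    {Ω : Type*} [MeasurableSpace Ω] (μ : Measure Ω) [IsProbabilityMeasure μ]
    -- dimensions: `x ∈ ℝⁿ`, `P_k ∈ ℝ^{n×m}`, `Q_k ∈ ℝ^{n×d}`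
    (n m d : ℕ) (hm : 2 ≤ m) (hd : 1 ≤ d)
    -- the objective function
    (f : E n → ℝ) (hf : Differentiable ℝ f) (hconv : ConvexOn ℝ Set.univ f)
    (L : ℝ) (hL : 0 < L) (hLip : ∀ u v, ‖gradient f u - gradient f v‖ ≤ L * ‖u - v‖)
    -- parameters of the algorithm
    (β c M₁ M₂ : ℝ) (hβ : 0 < β) (hβ1 : β < 1) (hc : 0 < c) (hc1 : c < 1 / 2)
    (hM₁ : 0 < M₁) (hM₂ : 0 < M₂)
    -- initial data
    (S₀ : State n m)
    (hP : ∀ j, ‖(WithLp.toLp 2 (S₀.P.col j) : E n)‖ = 1 ∨ S₀.P.col j = 0)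
    (hH₁ : (S₀.H - M₁ • (1 : Matrix (Fin m) (Fin m) ℝ)).PosSemidef)
    (hH₂ : (M₂ • (1 : Matrix (Fin m) (Fin m) ℝ) - S₀.H).PosSemidef)
    (hR : levelRadius f S₀.x ≠ ⊤)
    -- the independent Gaussian matrices
    (Q : ℕ → Ω → Fin n → Fin d → ℝ) (hQm : ∀ k, Measurable (Q k))
    (hQlaw : ∀ k, μ.map (Q k) = gaussianMatrix n d) (hQind : iIndepFun Q μ) :
    -- absolute constants for the Gaussian tail bounds exist
    (∃ C₀ C : ℝ, ∀ n' d' : ℕ, 1 ≤ d' → d' ≤ n' →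
      IsVectorNormConst n' d' C₀ ∧ IsOpNormConst n' d' C) ∧
    -- fixed precision `ε`
    (∀ C₀ C : ℝ, IsVectorNormConst n d C₀ → IsOpNormConst n d C →
      ∀ δ : ℝ, 0 < δ → δ < 1 → 0 ≤ probBound C₀ δ d → ∀ ε : ℝ, 0 < ε → ∀ k : ℕ,
        Integrable (fun ω =>
          f (run f β c M₁ M₂ (fun _ => ε) (fun j => Matrix.of (Q j ω)) S₀ k).x - optVal f) μ ∧
        ∫ ω, (f (run f β c M₁ M₂ (fun _ => ε) (fun j => Matrix.of (Q j ω)) S₀ k).x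
            - optVal f) ∂μ ≤
          L * C ^ 2 * n ^ 2 * (levelRadius f S₀.x).toReal ^ 2 /
            (2 * C ^ 2 * n ^ 2 + L * c * M₁ * probBound C₀ δ d * (1 - δ) ^ 2 * d ^ 2 * k
              * alphaBar β c M₂ L m)
          + 2 * (levelRadius f S₀.x).toReal * constK C δ c M₁ M₂ L n m d * ε) ∧
    -- precisions `ε_k = O(1/k)`
    (∀ ε : ℕ → ℝ, (∀ k, 0 < ε k) → ε =O[atTop] (fun k : ℕ => 1 / (k : ℝ)) →
      (∀ k, Integrable (fun ω =>
        f (run f β c M₁ M₂ ε (fun j => Matrix.of (Q j ω)) S₀ k).x - optVal f) μ) ∧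
      (fun k : ℕ => ∫ ω, (f (run f β c M₁ M₂ ε (fun j => Matrix.of (Q j ω)) S₀ k).x
        - optVal f) ∂μ) =O[atTop] (fun k : ℕ => 1 / (k : ℝ))) := by
  have hS₀ : Admissible M₁ M₂ S₀ := by
    refine ⟨fun j => ?_, hH₁, hH₂⟩
    rcases hP j with h | h
    · exact h.le
    · rw [h]; simp
  refine ⟨⟨1 / 8, 96, fun n' d' hd' hdn' => ⟨isVectorNormConst_eighth hd',
    isOpNormConst_of_le hd' hdn'⟩⟩, ?_, ?_⟩
  · intro C₀ C hC₀ hC δ hδ hδ1 hp ε hε k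
    exact ⟨integrable_gap hf.continuous hm hβ hc hM₁ hS₀ hR hQm _ k,
      expGap_le hf hconv hL hLip hβ hβ1 hc hc1 hM₁ hM₂ hm hd hS₀ hR hQm hQlaw hQind hC₀ hC hδ hδ1
        hp hε k⟩
  · intro ε hε hεO
    exact ⟨integrable_gap hf.continuous hm hβ hc hM₁ hS₀ hR hQm ε,
      expGap_isBigO hf hconv hL hLip hβ hβ1 hc hc1 hM₁ hM₂ hm hd hS₀ hR hQm hQlaw hQind hε hεO⟩
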